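/- Setting. Let $\mathcal X$ be a measurable space and let $\mathcal F$ be a class of measurable hypotheses $f:\mathcal X\to\{0,1\}$ of (finite) VC dimension $d$. There are $k\ge 2$ players with arbitrary probability distributions $D_1,\dots,D_k$ on $\mathcal X\times\{0,1\}$. Put $\mathrm{err}_D(f)=\Pr_{(x,y)\sim D}[f(x)\ne y]$, let $\mathrm{err}_S(f)$ be the fraction of examples of a finite sample $S$ that $f$ mislabels, and let $\mathrm{OPT}=\inf_{f\in\mathcal F}\max_{i\in[k]}\mathrm{err}_{D_i}(f)$ (which need not be $0$). Let $\epsilon,\delta\in(0,1)$ and $7\epsilon/6<\alpha<1$, and set $$\alpha'=\alpha/35,\qquad \epsilon'=\epsilon/60,\qquad t=2\lceil \ln(k)/\alpha'^3\rceil,\qquad \delta'=\delta/(4t).$$ Let $\mathcal O_{\mathcal F}$ be an empirical risk minimizer: it maps every labelled sample $S$ to some $\mathcal O_{\mathcal F}(S)\in\mathcal F$ with $\mathrm{err}_S(\mathcal O_{\mathcal F}(S))\le\inf_{f\in\mathcal F}\mathrm{err}_S(f)+\epsilon'$, and $(S,x)\mapsto\mathcal O_{\mathcal F}(S)(x)$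 is measurable. Algorithm NR1 with sample sizes $n_S,n_T$: start with $w_i^{(0)}=1$ for all $i\in[k]$. In round $r=1,\dots,t$, draw a sample $S^{(r)}$ of $n_S$ independent examples from the mixture $\tilde D^{(r-1)}=\frac1{\Phi^{(r-1)}}\sum_{i=1}^k w_i^{(r-1)}D_i$, where $\Phi^{(r-1)}=\sum_{i=1}^k w_i^{(r-1)}$; let $f^{(r)}=\mathcal O_{\mathcal F}(S^{(r)})$; for each player $i$ draw a fresh sample $T_i$ of $n_T$ independent examples from $D_i$; and update $$w_i^{(r)}=w_i^{(r-1)}\bigl(1+s_i^{(r)}\bigr),\qquad s_i^{(r)}=\min\left(\frac{\mathrm{err}_{T_i}(f^{(r)})\,\alpha'^2}{(1+3\alpha')\,\mathrm{err}_{S^{(r)}}(f^{(r)})+3\epsilon'},\ \alpha'\right).$$ Return the majority vote $f_{\mathrm{NR1}}=\mathrm{maj}(f^{(1)},\dots,f^{(t)})$, where a tie is resolved as the label $0$. Theorem 3. There are a universal constant $C>0$ and sample sizes $n_S,n_T$, depending only on $d,k,\epsilon,\delta,\alpha$, with $$n_S\le \frac{C}{\alpha'\epsilon'}\Bigl(d\ln\frac1{\epsilon'}+\ln\frac1{\delta'}\Bigr),\qquad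 n_T\le\frac{C}{\alpha'\epsilon'}\ln\frac{k}{\delta'},$$ such that, for all $\mathcal X$, $\mathcal F$, $\mathcal O_{\mathcal F}$ and $D_1,\dots,D_k$ as above, with probability at least $1-\delta$ the classifier returned by Algorithm NR1 satisfies $$\mathrm{err}_{D_i}(f_{\mathrm{NR1}})\le(2+\alpha)\,\mathrm{OPT}+\epsilon\qquad\text{for all } i\in[k],$$ and the total number $m=t\,(n_S+k\,n_T)$ of examples drawn satisfies $$m\le C\cdot\frac{\ln k}{\alpha^4\epsilon}\Bigl(d\ln\frac1\epsilon+k\ln\frac k\delta\Bigr).$$ -/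

import Mathlib

open MeasureTheory

namespace CollabPAC

noncomputable section

/-! ### Hypothesis classes, errors, VC dimension -/

/-- A hypothesis class `F` shatters the finite set `A` if every labelling of `A` is realized by some
member of `F`. -/
def Shatters {X : Type*} (F : Set (X → Bool)) (A : Finset X) : Prop :=
  ∀ g : X → Bool, ∃ f ∈ F, ∀ x ∈ A, f x = g x

/-- `F` has VC dimension exactly `d` (so the dimension is finite, and `F` is non-empty). -/
def HasVCDim {X : Type*} (F : Set (X → Bool)) (d : ℕ) : Prop :=
  (∃ A : Finset X, A.card = d ∧ Shatters F A) ∧ ∀ A : Finset X, Shatters F A → A.card ≤ d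

/-- The error `Pr_{(x,y) ∼ D} [f x ≠ y]`. -/
def err {X : Type*} [MeasurableSpace X] (D : Measure (X × Bool)) (f : X → Bool) : ℝ :=
  D.real {p | f p.1 ≠ p.2}

/-- The error of `f` on a sample of size `n`: the fraction of mislabelled examples. -/
def empErr {X : Type*} {n : ℕ} (S : Fin n → X × Bool) (f : X → Bool) : ℝ :=
  ((Finset.univ.filter fun j => f (S j).1 ≠ (S j).2).card : ℝ) / n

/-- `OPT = inf_{f ∈ F} max_i err_{D_i}(f)`. -/
def OPT {X : Type*} [MeasurableSpace X] {k : ℕ} (F : Set (X → Bool))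
    (D : Fin k → Measure (X × Bool)) : ℝ :=
  ⨅ f : F, ⨆ i : Fin k, err (D i) f.1

/-- A learning rule: a map that takes a labelled sample (of any size) to a classifier. -/
abbrev LearningRule (X : Type*) : Type _ := (n : ℕ) → (Fin n → X × Bool) → X → Bool

/-- `O` is an empirical risk minimizer for `F`, up to the additive tolerance `τ`. -/
def IsERM {X : Type*} (F : Set (X → Bool)) (τ : ℝ) (O : LearningRule X) : Prop :=
  ∀ (n : ℕ) (S : Fin n → X × Bool),
    O n S ∈ F ∧ empErr S (O n S) ≤ (⨅ f : F, empErr S f.1) + τ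

/-- The label that the learning rule gives to a point depends measurably on sample and point. -/
def IsMeasurableRule {X : Type*} [MeasurableSpace X] (O : LearningRule X) : Prop :=
  ∀ n : ℕ, Measurable fun p : (Fin n → X × Bool) × X => O n p.1 p.2

/-- The majority vote of `t` classifiers (a tie is resolved in favour of the label `false`). -/
def maj {X : Type*} {t : ℕ} (f : Fin t → X → Bool) (x : X) : Bool :=
  decide (t < 2 * (Finset.univ.filter fun r => f r x = true).card)

/-! ### The parameters of the algorithm -/

/-- `α' = α / 35`. -/
def aPar (α : ℝ) : ℝ := α / 35

/-- `ε' = ε / 60`. -/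
def ePar (ε : ℝ) : ℝ := ε / 60

/-- The number of rounds `t = 2 ⌈ln k / α'³⌉`. -/
def rounds (k : ℕ) (α : ℝ) : ℕ := 2 * ⌈Real.log k / aPar α ^ 3⌉₊

/-- `δ' = δ / (4t)`. -/
def dPar (k : ℕ) (α δ : ℝ) : ℝ := δ / (4 * rounds k α)

/-! ### One round and the run of the algorithm -/

/-- The examples drawn in one round: the sample `S` of size `nS` from the mixture, and for every
player `i` the sample `T i` of size `nT`. -/
abbrev RoundData (X : Type*) (k nS nT : ℕ) : Type _ :=
  (Fin nS → X × Bool) × (Fin k → Fin nT → X × Bool)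

/-- The increment `s_i` of player `i` in a round with data `(S, T)`, where `f = O(S)`:
`min (err_{T_i}(f) α'² / ((1 + 3α') err_S(f) + 3ε')) α'`. -/
def score {X : Type*} {k nS nT : ℕ} (O : LearningRule X) (α ε : ℝ)
    (R : RoundData X k nS nT) (i : Fin k) : ℝ :=
  min (empErr (R.2 i) (O nS R.1) * aPar α ^ 2 /
      ((1 + 3 * aPar α) * empErr R.1 (O nS R.1) + 3 * ePar ε))
    (aPar α)

/-- The weights `w_i^{(r)}` after `r` rounds with data `h`: `w_i^{(0)} = 1` and
`w_i^{(r+1)} = w_i^{(r)} (1 + s_i^{(r+1)})`. -/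
def weight {X : Type*} {k nS nT : ℕ} (O : LearningRule X) (α ε : ℝ) :
    (r : ℕ) → (Fin r → RoundData X k nS nT) → Fin k → ℝ
  | 0, _, _ => 1
  | r + 1, h, i =>
      weight O α ε r (fun j => h j.castSucc) i * (1 + score O α ε (h (Fin.last r)) i)

/-- The mixture `(1/Φ) ∑ i, w_i D_i` with `Φ = ∑ i, w_i`. -/
def mixture {X : Type*} [MeasurableSpace X] {k : ℕ} (w : Fin k → ℝ)
    (D : Fin k → Measure (X × Bool)) : Measure (X × Bool) :=
  ∑ i, ENNReal.ofReal (w i / ∑ j, w j) • D i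

/-- The law of the data of a round that starts with weights `w`: `nS` independent examples from the
mixture, and independently of them, for each player `i`, `nT` independent examples from `D i`. -/
def roundLaw {X : Type*} [MeasurableSpace X] {k : ℕ} (nS nT : ℕ)
    (D : Fin k → Measure (X × Bool)) (w : Fin k → ℝ) : Measure (RoundData X k nS nT) :=
  (Measure.pi fun _ : Fin nS => mixture w D).prod
    (Measure.pi fun i : Fin k => Measure.pi fun _ : Fin nT => D i)

/-- The law of the data of the first `r` rounds: given the data `h` of the earlier rounds, the next
round is drawn from `roundLaw` with the current weights. -/
def runLaw {X : Type*} [MeasurableSpace X] {k : ℕ} (nS nT : ℕ) (O : LearningRule X) (α ε : ℝ)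
    (D : Fin k → Measure (X × Bool)) : (r : ℕ) → Measure (Fin r → RoundData X k nS nT)
  | 0 => Measure.dirac Fin.elim0
  | r + 1 => (runLaw nS nT O α ε D r).bind fun h =>
      (roundLaw nS nT D (weight O α ε r h)).map fun R =>
        (Fin.snoc (α := fun _ => RoundData X k nS nT) h R : Fin (r + 1) → RoundData X k nS nT)

/-- The classifier returned by the algorithm when `h` is the data of all rounds: the majority vote of
the classifiers `f^{(r)} = O(S^{(r)})`. -/
def output {X : Type*} {k nS nT t : ℕ} (O : LearningRule X)
    (h : Fin t → RoundData X k nS nT) : X → Bool :=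
  maj fun r => O nS (h r).1

/-- The number of examples that the algorithm draws: `nS + k * nT` in each round. -/
def sampleCount (k nS nT : ℕ) (α : ℝ) : ℕ := rounds k α * (nS + k * nT)

end

end CollabPAC

/-! Write `a` = α', `e` = ε', Φ for the total weight and c for `scale`, so that a score is min(c ·
err_T, a). The argument plays log w_i ≤ log Φ against two estimates. Unless the mixture sample of a
round misleads, the error of the round's classifier on the mixture is controlled by the denominator
of the score (`scale_mul_mixErr_le`), so the average increment is about a², and log Φ is at most
about ln k + a²t. On the other side log w_i is nearly the sum of the increments of player i, that
is, of its truncated errors min(c · err, a). Hence these truncated errors sum to at most a²t(1 + 7a)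
(`sum_truncated_err_le`). Comparing the minimizer with a nearly optimal f₀ gives c ≥ a²/Q in every
round, with Q close to OPT. Where the majority errs, at least half of the voters err; if it errs
with probability P, then tP ≤ 2 ∑ min(err f_r, P). This truncation is compatible with the cap a, and
P ≤ 2(1 + 7a)Q follows (`err_maj_le`, `err_output_le`).

Two kinds of randomness are treated differently. For the mixture samples, a relative VC bound
(`lintegral_exp_err_sub_le`, by ghost sample and swaps) holds in each round, with a union bound over
rounds. The player samples have size governed by ln(k/δ) rather than ln(k/δ'), as the bound on m
requires, and are not controlled round by round. Only sums over rounds matter: `avgExcess` and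
`shortfall` have conditional exponential moment at most 1, so the exponentials of their sums are
supermartingales (`runLaw_lt_runSum_le`), and only k + 1 tail events are paid for.

In the sample count, ln(1/δ') is at most ln(k/δ) + 4 ln(1/e), which the target absorbs when d ≥ 1.
For d = 0 the class is a single classifier and no examples are needed. -/

namespace CollabPAC

/-! ### Hits of a sample and their exponential moments -/

/-- The examples that `f` mislabels. -/
def errSet {X : Type*} (f : X → Bool) : Set (X × Bool) := {p | f p.1 ≠ p.2}

/-- The number of points of the sample `S` that lie in `E`. -/
noncomputable def hits {Z : Type*} {n : ℕ} (S : Fin n → Z) (E : Set Z) : ℝ :=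
  ∑ j, E.indicator 1 (S j)

lemma empErr_eq {X : Type*} {n : ℕ} (S : Fin n → X × Bool) (f : X → Bool) :
    empErr S f = hits S (errSet f) / n := by
  simp only [empErr, hits, errSet, Set.indicator_apply, Pi.one_apply, Set.mem_ofPred_eq,
    Finset.sum_boole]

lemma measurableSet_errSet {X : Type*} [MeasurableSpace X] {f : X → Bool} (hf : Measurable f) :
    MeasurableSet (errSet f) :=
  (measurableSet_eq_fun (hf.comp measurable_fst) measurable_snd).compl

lemma measurable_hits {Z : Type*} [MeasurableSpace Z] {n : ℕ} {E : Set Z}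
    (hE : MeasurableSet E) : Measurable fun S : Fin n → Z => hits S E := by
  unfold hits
  exact Finset.measurable_sum _ fun j _ =>
    (measurable_one.indicator hE).comp (measurable_pi_apply j)

lemma exp_mul_hits {Z : Type*} {n : ℕ} (S : Fin n → Z) (E : Set Z) (θ : ℝ) :
    Real.exp (θ * hits S E) = ∏ j, Real.exp (θ * E.indicator 1 (S j)) := by
  rw [hits, Finset.mul_sum, Real.exp_sum]

lemma integral_exp_indicator {Z : Type*} [MeasurableSpace Z] (μ : Measure Z)
    [IsProbabilityMeasure μ] {E : Set Z} (hE : MeasurableSet E) (θ : ℝ) :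
    Integrable (fun z => Real.exp (θ * E.indicator 1 z)) μ ∧
      ∫ z, Real.exp (θ * E.indicator 1 z) ∂μ = 1 + μ.real E * (Real.exp θ - 1) := by
  have h : (fun z => Real.exp (θ * E.indicator 1 z)) =
      fun z => 1 + E.indicator (fun _ => Real.exp θ - 1) z := by
    funext z
    by_cases hz : z ∈ E <;> simp [hz]
  have hi : Integrable (E.indicator fun _ : Z => Real.exp θ - 1) μ :=
    (integrable_const _).indicator hE
  rw [h]
  refine ⟨(integrable_const _).add hi, ?_⟩
  rw [integral_add (integrable_const _) hi, integral_indicator_const _ hE]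
  simp

/-- The moment generating function of the number of hits of a random sample. -/
lemma lintegral_exp_hits {Z : Type*} [MeasurableSpace Z] (μ : Measure Z)
    [IsProbabilityMeasure μ] {E : Set Z} (hE : MeasurableSet E) (n : ℕ) (θ : ℝ) :
    ∫⁻ S, ENNReal.ofReal (Real.exp (θ * hits S E)) ∂(Measure.pi fun _ : Fin n => μ) =
      ENNReal.ofReal ((1 + μ.real E * (Real.exp θ - 1)) ^ n) := by
  have h1 := (integral_exp_indicator μ hE θ)
  simp_rw [exp_mul_hits]
  rw [← ofReal_integral_eq_lintegral_ofReal]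
  · congr 1
    have := integral_fintype_prod_eq_prod (𝕜 := ℝ) (ι := Fin n) (μ := fun _ => μ)
      (fun _ z => Real.exp (θ * E.indicator 1 z))
    rw [this, h1.2]
    simp
  · exact Integrable.fintype_prod (μ := fun _ => μ) (f := fun _ z => Real.exp (θ * E.indicator 1 z))
      fun _ => h1.1
  · exact Filter.Eventually.of_forall fun S => Finset.prod_nonneg fun j _ => (Real.exp_pos _).le

/-- Convexity of exp between 0 and θ gives e^{θp} ≤ 1 + p(e^θ - 1). This direction lets a ghost
sample replace the true error in an exponent. -/
lemma exp_mul_le_lintegral_exp_hits {Z : Type*} [MeasurableSpace Z] (μ : Measure Z)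
    [IsProbabilityMeasure μ] {E : Set Z} (hE : MeasurableSet E) (n : ℕ) (θ : ℝ) :
    ENNReal.ofReal (Real.exp (θ * (n * μ.real E))) ≤
      ∫⁻ S, ENNReal.ofReal (Real.exp (θ * hits S E)) ∂(Measure.pi fun _ : Fin n => μ) := by
  rw [lintegral_exp_hits μ hE]
  apply ENNReal.ofReal_le_ofReal
  rw [show θ * (n * μ.real E) = n * (θ * μ.real E) by ring, Real.exp_nat_mul]
  apply pow_le_pow_left₀ (Real.exp_pos _).le
  have h0 : 0 ≤ μ.real E := measureReal_nonneg
  have h1 : μ.real E ≤ 1 := measureReal_le_one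
  have := convexOn_exp.2 (Set.mem_univ 0) (Set.mem_univ θ) (sub_nonneg.2 h1) h0 (by ring)
  simp only [smul_eq_mul, mul_zero, zero_add, Real.exp_zero, mul_one] at this
  rw [mul_comm θ]
  linarith

lemma lintegral_exp_hits_le {Z : Type*} [MeasurableSpace Z] (μ : Measure Z)
    [IsProbabilityMeasure μ] {E : Set Z} (hE : MeasurableSet E) (n : ℕ) (θ : ℝ) :
    ∫⁻ S, ENNReal.ofReal (Real.exp (θ * hits S E)) ∂(Measure.pi fun _ : Fin n => μ) ≤
      ENNReal.ofReal (Real.exp (n * (μ.real E * (Real.exp θ - 1)))) := by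
  rw [lintegral_exp_hits μ hE]
  apply ENNReal.ofReal_le_ofReal
  rw [Real.exp_nat_mul]
  have h0 : 0 ≤ μ.real E := measureReal_nonneg
  have h1 : μ.real E ≤ 1 := measureReal_le_one
  apply pow_le_pow_left₀
  · nlinarith [Real.exp_pos θ]
  · linarith [Real.add_one_le_exp (μ.real E * (Real.exp θ - 1))]

/-- Markov's inequality for an exponential moment. -/
lemma meas_lt_le_of_lintegral_exp_le {Ω : Type*} [MeasurableSpace Ω] (μ : Measure Ω) {f : Ω → ℝ}
    (hf : Measurable f) {M : ℝ}
    (h : ∫⁻ ω, ENNReal.ofReal (Real.exp (f ω)) ∂μ ≤ ENNReal.ofReal M) (u : ℝ) :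
    μ {ω | u < f ω} ≤ ENNReal.ofReal (Real.exp (-u) * M) := by
  have h1 := mul_meas_ge_le_lintegral (μ := μ)
    (f := fun ω => ENNReal.ofReal (Real.exp (f ω))) (by fun_prop) (ENNReal.ofReal (Real.exp u))
  have h2 : μ {ω | u < f ω} ≤
      μ {ω | ENNReal.ofReal (Real.exp u) ≤ ENNReal.ofReal (Real.exp (f ω))} :=
    measure_mono fun ω hω => ENNReal.ofReal_le_ofReal (Real.exp_le_exp.2 (le_of_lt hω))
  have h3 : ENNReal.ofReal (Real.exp (-u)) * ENNReal.ofReal (Real.exp u) = 1 := by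
    rw [← ENNReal.ofReal_mul (Real.exp_pos _).le, ← Real.exp_add]
    simp
  calc μ {ω | u < f ω} = ENNReal.ofReal (Real.exp (-u)) * (ENNReal.ofReal (Real.exp u) *
        μ {ω | u < f ω}) := by rw [← mul_assoc, h3, one_mul]
    _ ≤ ENNReal.ofReal (Real.exp (-u)) * ENNReal.ofReal M := by
        gcongr
        exact (mul_le_mul_right h2 _).trans (h1.trans h)
    _ = _ := (ENNReal.ofReal_mul (Real.exp_pos _).le).symm

/-! ### Error patterns and the Sauer–Shelah bound -/

open Classical in
/-- The sets of indices on which a member of `F` errs on the labelled points `z`. -/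
noncomputable def errPatterns {X ι : Type*} [Fintype ι] (F : Set (X → Bool)) (z : ι → X × Bool) :
    Finset (Finset ι) :=
  Finset.univ.filter fun P => ∃ f ∈ F, ∀ i, i ∈ P ↔ f (z i).1 ≠ (z i).2

lemma mem_errPatterns {X ι : Type*} [Fintype ι] {F : Set (X → Bool)} {z : ι → X × Bool}
    {P : Finset ι} : P ∈ errPatterns F z ↔ ∃ f ∈ F, ∀ i, i ∈ P ↔ f (z i).1 ≠ (z i).2 := by
  simp [errPatterns]

-- Shattered indices carry distinct points: for a repeated point the pattern ∅ forces equal labels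
-- and the pattern {i} forces different ones. Comparison with the given labels then turns error
-- patterns into labellings.
open Classical in
lemma card_le_of_shatters_errPatterns {X ι : Type*} [Fintype ι] {F : Set (X → Bool)} {d : ℕ}
    (hd : ∀ A : Finset X, Shatters F A → A.card ≤ d) {z : ι → X × Bool} {B : Finset ι}
    (hB : (errPatterns F z).Shatters B) : B.card ≤ d := by
  have key : ∀ t ⊆ B, ∃ f ∈ F, ∀ i ∈ B, i ∈ t ↔ f (z i).1 ≠ (z i).2 := by
    intro t ht
    obtain ⟨u, hu, rfl⟩ := hB ht
    obtain ⟨f, hf, hfu⟩ := mem_errPatterns.1 hu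
    exact ⟨f, hf, fun i hi => by simp [hi, hfu]⟩
  have hinj : Set.InjOn (fun i => (z i).1) B := by
    intro i hi j hj hij
    by_contra hne
    simp only at hij
    obtain ⟨f, -, hf⟩ := key ∅ (by simp)
    obtain ⟨g, -, hg⟩ := key {i} (by simpa using hi)
    have h1 := hf i hi
    have h2 := hf j hj
    have h3 := hg i hi
    have h4 := hg j hj
    have hne' : ¬ j = i := fun h => hne h.symm
    simp only [Finset.notMem_empty, false_iff, not_not, Finset.mem_singleton, true_iff,
      hne'] at h1 h2 h3 h4
    rw [hij] at h1 h3
    exact h3 (by rw [h4, ← h2, h1])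
  rw [← Finset.card_image_of_injOn hinj]
  apply hd
  intro g
  obtain ⟨f, hf, h⟩ := key (B.filter fun i => g (z i).1 ≠ (z i).2) (Finset.filter_subset _ _)
  refine ⟨f, hf, fun x hx => ?_⟩
  obtain ⟨i, hi, rfl⟩ := Finset.mem_image.1 hx
  have := h i hi
  simp only [Finset.mem_filter, hi, true_and] at this
  revert this
  cases f (z i).1 <;> cases g (z i).1 <;> cases (z i).2 <;> simp

/-- The Sauer–Shelah bound, in a form with a free parameter `x`. -/
lemma card_errPatterns_le {X ι : Type*} [Fintype ι] {F : Set (X → Bool)} {d : ℕ}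
    (hd : ∀ A : Finset X, Shatters F A → A.card ≤ d) (z : ι → X × Bool) {x : ℝ} (hx : 0 < x)
    (hx1 : x ≤ 1) :
    ((errPatterns F z).card : ℝ) ≤ (x⁻¹) ^ d * Real.exp (x * Fintype.card ι) := by
  classical
  set v := (errPatterns F z).vcDim with hv
  have hvd : v ≤ d := Finset.sup_le fun s hs =>
    card_le_of_shatters_errPatterns hd (Finset.mem_shatterer.1 hs)
  have hvm : v ≤ Fintype.card ι := Finset.sup_le fun s _ => Finset.card_le_univ s
  have h1 : (errPatterns F z).card ≤ ∑ k ∈ Finset.Iic v, (Fintype.card ι).choose k :=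
    (Finset.card_le_card_shatterer _).trans Finset.card_shatterer_le_sum_vcDim
  -- Since x ≤ 1, each term of degree at most d may be multiplied by x⁻ᵈxᵏ ≥ 1; the sum then
  -- completes to the binomial expansion of x⁻ᵈ(1 + x)^m.
  calc ((errPatterns F z).card : ℝ) ≤ ∑ k ∈ Finset.Iic v, ((Fintype.card ι).choose k : ℝ) := by
        exact_mod_cast h1
    _ ≤ ∑ k ∈ Finset.Iic v, (x⁻¹) ^ d * (x ^ k * 1 ^ (Fintype.card ι - k) *
          ((Fintype.card ι).choose k : ℝ)) := by
        refine Finset.sum_le_sum fun k hk => ?_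
        have hkd : k ≤ d := (Finset.mem_Iic.1 hk).trans hvd
        have h2 : 1 ≤ (x⁻¹) ^ d * x ^ k := by
          have : (x⁻¹) ^ d * x ^ k = (x⁻¹) ^ (d - k) := by
            rw [← Nat.sub_add_cancel hkd, pow_add, mul_assoc, ← mul_pow, inv_mul_cancel₀ hx.ne']
            simp
          rw [this]
          exact one_le_pow₀ ((one_le_inv₀ hx).2 hx1)
        calc ((Fintype.card ι).choose k : ℝ) = 1 * ((Fintype.card ι).choose k : ℝ) := by ring
          _ ≤ (x⁻¹) ^ d * x ^ k * ((Fintype.card ι).choose k : ℝ) := by gcongr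
          _ = _ := by simp; ring
    _ ≤ ∑ k ∈ Finset.range (Fintype.card ι + 1), (x⁻¹) ^ d * (x ^ k * 1 ^ (Fintype.card ι - k) *
          ((Fintype.card ι).choose k : ℝ)) := by
        refine Finset.sum_le_sum_of_subset_of_nonneg ?_ fun k _ _ => by positivity
        intro k hk
        have := Finset.mem_Iic.1 hk
        simp only [Finset.mem_range]
        lia
    _ = (x⁻¹) ^ d * (x + 1) ^ (Fintype.card ι) := by rw [← Finset.mul_sum, add_pow]
    _ ≤ (x⁻¹) ^ d * Real.exp (x * Fintype.card ι) := by
        gcongr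
        rw [mul_comm, Real.exp_nat_mul]
        gcongr
        exact Real.add_one_le_exp x

/-! ### Symmetrization and the relative VC bound -/

/-- Exchange the two components of the pairs with index in `σ`. -/
def swapPairs {Z : Type*} {n : ℕ} (σ : Fin n → Bool) (W : Fin n → Z × Z) : Fin n → Z × Z :=
  fun j => bif σ j then (W j).swap else W j

lemma measurePreserving_swapPairs {Z : Type*} [MeasurableSpace Z] (μ : Measure Z)
    [IsProbabilityMeasure μ] {n : ℕ} (σ : Fin n → Bool) :
    MeasurePreserving (swapPairs (Z := Z) σ) (Measure.pi fun _ => μ.prod μ)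
      (Measure.pi fun _ => μ.prod μ) := by
  have := measurePreserving_pi (fun _ : Fin n => μ.prod μ) (fun _ : Fin n => μ.prod μ)
    (f := fun j p => bif σ j then p.swap else p) fun j => by
      cases σ j
      · exact MeasurePreserving.id _
      · exact Measure.measurePreserving_swap
  exact this

lemma lintegral_pair {Z : Type*} [MeasurableSpace Z] (μ : Measure Z) [IsProbabilityMeasure μ]
    {n : ℕ} {G : (Fin n → Z) × (Fin n → Z) → ENNReal} (hG : Measurable G) :
    ∫⁻ S, ∫⁻ S', G (S, S') ∂(Measure.pi fun _ => μ) ∂(Measure.pi fun _ => μ) =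
      ∫⁻ W, G (fun j => (W j).1, fun j => (W j).2) ∂(Measure.pi fun _ => μ.prod μ) := by
  rw [← lintegral_prod _ hG.aemeasurable]
  exact ((measurePreserving_arrowProdEquivProdArrow Z Z (Fin n) (fun _ => μ)
    (fun _ => μ)).lintegral_comp hG).symm

/-- The first-order terms leave -τγ, and the quadratic errors are at most τ² + 4τ² = 5τ² ≤ τγ. -/
lemma exp_add_exp_neg_le_two {γ τ : ℝ} (hγ : 0 ≤ γ) (hγ1 : γ ≤ 1) (hτ : 0 ≤ τ)
    (hτγ : 5 * τ ≤ γ) : Real.exp τ + Real.exp (-(τ * (1 + γ))) ≤ 2 := by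
  have h1 := Real.abs_exp_sub_one_sub_id_le (x := τ) (by rw [abs_le]; constructor <;> linarith)
  have h2 := Real.abs_exp_sub_one_sub_id_le (x := -(τ * (1 + γ)))
    (by rw [abs_le]; constructor <;> nlinarith)
  have h3 := (abs_le.1 h1).2
  have h4 := (abs_le.1 h2).2
  have h5 : (-(τ * (1 + γ))) ^ 2 ≤ 4 * τ ^ 2 := by
    have : (1 + γ) ^ 2 ≤ 4 := by nlinarith
    nlinarith [sq_nonneg τ]
  nlinarith

/-- One pair with a random order. Exactly one error gives e^τ + e^{-τ(1+γ)}; two errors give e^{-τγ}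
twice; no error gives 1 twice. -/
lemma sum_exp_swap_le_two {γ τ : ℝ} (hγ : 0 ≤ γ) (hγ1 : γ ≤ 1) (hτ : 0 ≤ τ)
    (hτγ : 5 * τ ≤ γ) (A B : Prop) [Decidable A] [Decidable B] :
    ∑ s : Bool, Real.exp (τ * ((bif s then (if A then 1 else 0) else (if B then 1 else 0)) -
      (1 + γ) * (bif s then (if B then 1 else 0) else (if A then 1 else 0)))) ≤ 2 := by
  have h := exp_add_exp_neg_le_two hγ hγ1 hτ hτγ
  have h1 : Real.exp (τ * (1 - (1 + γ))) ≤ 1 := by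
    rw [Real.exp_le_one_iff]; nlinarith
  rw [Fintype.sum_bool]
  rw [← mul_neg] at h
  by_cases hA : A <;> by_cases hB : B <;>
    simp only [hA, hB, if_true, if_false, cond_true, cond_false, mul_one, mul_zero, sub_zero,
      zero_sub, Real.exp_zero] <;> linarith

open Classical in
/-- Symmetrization: on average over all swaps, the exponential moment of the difference between
the two halves of a sample is at most the number of error patterns. -/
lemma sum_swapPairs_le {X : Type*} {F : Set (X → Bool)} {n : ℕ} {O : (Fin n → X × Bool) → X → Bool}
    (hO : ∀ S, O S ∈ F) {γ τ : ℝ} (hγ : 0 ≤ γ) (hγ1 : γ ≤ 1) (hτ : 0 ≤ τ) (hτγ : 5 * τ ≤ γ)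
    (W : Fin n → (X × Bool) × (X × Bool)) :
    ∑ σ : Fin n → Bool, Real.exp (τ *
      (hits (fun j => (swapPairs σ W j).2) (errSet (O fun j => (swapPairs σ W j).1)) -
        (1 + γ) * hits (fun j => (swapPairs σ W j).1)
          (errSet (O fun j => (swapPairs σ W j).1)))) ≤
      2 ^ n * (errPatterns F (Sum.elim (fun j => (W j).1) (fun j => (W j).2))).card := by
  set z : Fin n ⊕ Fin n → X × Bool := Sum.elim (fun j => (W j).1) (fun j => (W j).2) with hz
  -- The classifier depends on σ, but its error pattern on the double sample is one of `errPatterns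
  -- F z`, a set independent of σ. For a fixed pattern the exponential is a product over pairs, so
  -- the sum over σ factorizes.
  let H : (Fin n → Bool) → Finset (Fin n ⊕ Fin n) → ℝ := fun σ P =>
    ∏ j, Real.exp (τ * ((bif σ j then (if Sum.inl j ∈ P then 1 else 0) else
      (if Sum.inr j ∈ P then 1 else 0)) -
      (1 + γ) * (bif σ j then (if Sum.inr j ∈ P then 1 else 0) else
        (if Sum.inl j ∈ P then 1 else 0))))
  have hH : ∀ σ P, 0 ≤ H σ P := fun σ P => Finset.prod_nonneg fun j _ => (Real.exp_pos _).le
  have h1 : ∀ σ : Fin n → Bool, Real.exp (τ *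
      (hits (fun j => (swapPairs σ W j).2) (errSet (O fun j => (swapPairs σ W j).1)) -
        (1 + γ) * hits (fun j => (swapPairs σ W j).1)
          (errSet (O fun j => (swapPairs σ W j).1)))) ≤ ∑ P ∈ errPatterns F z, H σ P := by
    intro σ
    set f := O fun j => (swapPairs σ W j).1
    set P : Finset (Fin n ⊕ Fin n) := Finset.univ.filter fun i => f (z i).1 ≠ (z i).2 with hP
    have hPm : P ∈ errPatterns F z := mem_errPatterns.2 ⟨f, hO _, fun i => by simp [hP]⟩
    refine le_trans (le_of_eq ?_) (Finset.single_le_sum (fun Q _ => hH σ Q) hPm)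
    simp only [H, ← Real.exp_sum, hits, ← Finset.mul_sum, Finset.sum_sub_distrib]
    congr 3
    · refine Finset.sum_congr rfl fun j _ => ?_
      cases hσ : σ j <;> simp [swapPairs, hσ, hP, hz, errSet, Set.indicator_apply]
    · congr 1
      refine Finset.sum_congr rfl fun j _ => ?_
      cases hσ : σ j <;> simp [swapPairs, hσ, hP, hz, errSet, Set.indicator_apply]
  refine (Finset.sum_le_sum fun σ _ => h1 σ).trans ?_
  rw [Finset.sum_comm]
  have h2 : ∀ P ∈ errPatterns F z, ∑ σ, H σ P ≤ 2 ^ n := by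
    intro P _
    simp only [H]
    rw [← Fintype.prod_sum (f := fun (j : Fin n) (s : Bool) => Real.exp (τ *
      ((bif s then (if Sum.inl j ∈ P then 1 else 0) else (if Sum.inr j ∈ P then 1 else 0)) -
      (1 + γ) * (bif s then (if Sum.inr j ∈ P then 1 else 0) else
        (if Sum.inl j ∈ P then 1 else 0)))))]
    calc _ ≤ ∏ _j : Fin n, (2 : ℝ) := Finset.prod_le_prod
          (fun j _ => Finset.sum_nonneg fun s _ => (Real.exp_pos _).le)
          (fun j _ => sum_exp_swap_le_two hγ hγ1 hτ hτγ _ _)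
      _ = 2 ^ n := by simp
  calc _ ≤ ∑ P ∈ errPatterns F z, (2 : ℝ) ^ n := Finset.sum_le_sum h2
    _ = _ := by rw [Finset.sum_const, nsmul_eq_mul, mul_comm]

/-- The number of errors of a classifier that is chosen measurably from one sample is measurable. -/
lemma measurable_hits_errSet {X Y : Type*} [MeasurableSpace X] [MeasurableSpace Y] {n : ℕ}
    {O : Y → X → Bool} (hO : Measurable fun p : Y × X => O p.1 p.2) :
    Measurable fun p : Y × (Fin n → X × Bool) => hits p.2 (errSet (O p.1)) := by
  unfold hits
  refine Finset.measurable_sum _ fun j _ => ?_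
  have hE : MeasurableSet {q : Y × (X × Bool) | O q.1 q.2.1 ≠ q.2.2} :=
    (measurableSet_eq_fun (hO.comp (by fun_prop : Measurable
      fun q : Y × (X × Bool) => (q.1, q.2.1))) (by fun_prop)).compl
  have : (fun p : Y × (Fin n → X × Bool) => (errSet (O p.1)).indicator (1 : X × Bool → ℝ) (p.2 j)) =
      fun p => Set.indicator {q : Y × (X × Bool) | O q.1 q.2.1 ≠ q.2.2} 1 (p.1, p.2 j) := by
    funext p
    simp [errSet, Set.indicator_apply]
  rw [this]
  exact (measurable_one.indicator hE).comp (by fun_prop)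

lemma measurable_err {X Y : Type*} [MeasurableSpace X] [MeasurableSpace Y]
    (μ : Measure (X × Bool)) [IsProbabilityMeasure μ]
    {O : Y → X → Bool} (hO : Measurable fun p : Y × X => O p.1 p.2) :
    Measurable fun y => err μ (O y) := by
  have hE : MeasurableSet {q : Y × (X × Bool) | O q.1 q.2.1 ≠ q.2.2} :=
    (measurableSet_eq_fun (hO.comp (by fun_prop : Measurable
      fun q : Y × (X × Bool) => (q.1, q.2.1))) (by fun_prop)).compl
  exact (measurable_measure_prodMk_left (ν := μ) hE).ennreal_toReal

lemma measurable_of_jointly {X Y : Type*} [MeasurableSpace X] [MeasurableSpace Y]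
    {O : Y → X → Bool} (hO : Measurable fun p : Y × X => O p.1 p.2) (y : Y) : Measurable (O y) :=
  hO.comp measurable_prodMk_left

/-- The exponential moment of the relative deviation between the true and the empirical error of a
classifier that is chosen from `F` on the basis of the sample. -/
lemma lintegral_exp_err_sub_le {X : Type*} [MeasurableSpace X] (μ : Measure (X × Bool))
    [IsProbabilityMeasure μ] {F : Set (X → Bool)} {d n : ℕ}
    (hd : ∀ A : Finset X, Shatters F A → A.card ≤ d) {O : (Fin n → X × Bool) → X → Bool}
    (hOF : ∀ S, O S ∈ F) (hO : Measurable fun p : (Fin n → X × Bool) × X => O p.1 p.2)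
    {γ τ x : ℝ} (hγ : 0 ≤ γ) (hγ1 : γ ≤ 1) (hτ : 0 ≤ τ) (hτγ : 5 * τ ≤ γ) (hx : 0 < x)
    (hx1 : x ≤ 1) :
    ∫⁻ S, ENNReal.ofReal (Real.exp (τ * (n * err μ (O S) - (1 + γ) * hits S (errSet (O S)))))
      ∂(Measure.pi fun _ => μ) ≤ ENNReal.ofReal ((x⁻¹) ^ d * Real.exp (x * (n + n))) := by
  let G : (Fin n → X × Bool) × (Fin n → X × Bool) → ENNReal := fun p =>
    ENNReal.ofReal (Real.exp (τ * (hits p.2 (errSet (O p.1)) -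
      (1 + γ) * hits p.1 (errSet (O p.1)))))
  have hm1 := measurable_hits_errSet (n := n) hO
  have hm2 : Measurable fun S : Fin n → X × Bool => hits S (errSet (O S)) :=
    hm1.comp (measurable_id.prodMk measurable_id)
  have hG : Measurable G := by
    have : Measurable fun p : (Fin n → X × Bool) × (Fin n → X × Bool) =>
      hits p.1 (errSet (O p.1)) := hm2.comp measurable_fst
    fun_prop
  -- Ghost sample: by Jensen, the true error in the exponent is replaced by the hits of an
  -- independent second sample, with no lower bound on n needed.
  have h1 : ∀ S, ENNReal.ofReal (Real.exp (τ * (n * err μ (O S) -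
      (1 + γ) * hits S (errSet (O S))))) ≤ ∫⁻ S', G (S, S') ∂(Measure.pi fun _ => μ) := by
    intro S
    have hE := measurableSet_errSet (measurable_of_jointly hO S)
    have := exp_mul_le_lintegral_exp_hits μ hE n τ
    calc _ = ENNReal.ofReal (Real.exp (-(τ * ((1 + γ) * hits S (errSet (O S)))))) *
          ENNReal.ofReal (Real.exp (τ * (n * μ.real (errSet (O S))))) := by
          rw [← ENNReal.ofReal_mul (Real.exp_pos _).le, ← Real.exp_add]
          congr 2
          simp only [err, errSet]
          ring
      _ ≤ ENNReal.ofReal (Real.exp (-(τ * ((1 + γ) * hits S (errSet (O S)))))) *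
          ∫⁻ S', ENNReal.ofReal (Real.exp (τ * hits S' (errSet (O S))))
            ∂(Measure.pi fun _ : Fin n => μ) := by gcongr
      _ = _ := by
          rw [← lintegral_const_mul _ (by have := measurable_hits (n := n) hE; fun_prop)]
          refine lintegral_congr fun S' => ?_
          rw [← ENNReal.ofReal_mul (Real.exp_pos _).le, ← Real.exp_add]
          simp only [G]
          congr 2
          ring
  refine (lintegral_mono h1).trans ?_
  rw [lintegral_pair μ hG]
  set N := (x⁻¹) ^ d * Real.exp (x * (n + n)) with hN
  set I := ∫⁻ W, G (fun j => (W j).1, fun j => (W j).2) ∂(Measure.pi fun _ => μ.prod μ)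
  have hGm : Measurable fun W : Fin n → (X × Bool) × (X × Bool) =>
      G (fun j => (W j).1, fun j => (W j).2) := hG.comp (by fun_prop)
  have hswap : ∀ σ : Fin n → Bool, I = ∫⁻ W, G (fun j => (swapPairs σ W j).1,
      fun j => (swapPairs σ W j).2) ∂(Measure.pi fun _ => μ.prod μ) := fun σ =>
    ((measurePreserving_swapPairs μ σ).lintegral_comp hGm).symm
  -- Each of the 2^n swaps preserves the law of the pairs, so the integral equals its average over
  -- swaps, which is bounded pointwise.
  have hsum : (2 : ENNReal) ^ n * I ≤ (2 : ENNReal) ^ n * ENNReal.ofReal N := by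
    calc (2 : ENNReal) ^ n * I = ∑ _σ : Fin n → Bool, I := by simp
      _ = ∑ σ : Fin n → Bool, ∫⁻ W, G (fun j => (swapPairs σ W j).1,
            fun j => (swapPairs σ W j).2) ∂(Measure.pi fun _ => μ.prod μ) :=
          Finset.sum_congr rfl fun σ _ => hswap σ
      _ = ∫⁻ W, ∑ σ : Fin n → Bool, G (fun j => (swapPairs σ W j).1,
            fun j => (swapPairs σ W j).2) ∂(Measure.pi fun _ => μ.prod μ) :=
          (lintegral_finsetSum _ fun σ _ =>
            hGm.comp (measurePreserving_swapPairs μ σ).measurable).symm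
      _ ≤ ∫⁻ _W, (2 : ENNReal) ^ n * ENNReal.ofReal N ∂(Measure.pi fun _ : Fin n => μ.prod μ) := by
          refine lintegral_mono fun W => ?_
          simp only [G]
          rw [← ENNReal.ofReal_sum_of_nonneg fun σ _ => (Real.exp_pos _).le]
          have h2 : (2 : ENNReal) ^ n = ENNReal.ofReal (2 ^ n) := by
            rw [ENNReal.ofReal_pow (by norm_num)]; simp
          rw [h2, ← ENNReal.ofReal_mul (by positivity)]
          apply ENNReal.ofReal_le_ofReal
          refine (sum_swapPairs_le hOF hγ hγ1 hτ hτγ W).trans ?_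
          gcongr
          refine (card_errPatterns_le hd _ hx hx1).trans (le_of_eq ?_)
          simp [hN]
      _ = _ := by simp
  exact (ENNReal.mul_le_mul_iff_right (by simp) (by simp)).1 hsum

/-! ### Weights and sums along a run -/

section Weights

variable {X : Type*} {k nS nT : ℕ} (O : LearningRule X) (α ε : ℝ)

lemma empErr_nonneg {n : ℕ} (S : Fin n → X × Bool) (f : X → Bool) : 0 ≤ empErr S f := by
  unfold empErr; positivity

lemma aPar_pos {α : ℝ} (hα : 0 < α) : 0 < aPar α := by unfold aPar; positivity

lemma ePar_pos {ε : ℝ} (hε : 0 < ε) : 0 < ePar ε := by unfold ePar; positivity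

variable {α ε} in
lemma score_nonneg (hα : 0 < α) (hε : 0 < ε) (R : RoundData X k nS nT) (i : Fin k) :
    0 ≤ score O α ε R i := by
  have h1 := aPar_pos hα
  have h2 := ePar_pos hε
  have h3 := empErr_nonneg (R.2 i) (O nS R.1)
  have h4 := empErr_nonneg R.1 (O nS R.1)
  unfold score
  exact le_min (by positivity) h1.le

lemma score_le (R : RoundData X k nS nT) (i : Fin k) : score O α ε R i ≤ aPar α :=
  min_le_right _ _

variable {α ε} in
lemma weight_pos (hα : 0 < α) (hε : 0 < ε) (r : ℕ) (h : Fin r → RoundData X k nS nT)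
    (i : Fin k) : 0 < weight O α ε r h i := by
  induction r with
  | zero => simp [weight]
  | succ r ih =>
    have := score_nonneg O hα hε (h (Fin.last r)) i
    have := ih fun j => h j.castSucc
    rw [weight]
    positivity

/-- The weights with which round `j` of the run `h` starts. -/
noncomputable def weightAt {r : ℕ} (h : Fin r → RoundData X k nS nT) (j : Fin r) : Fin k → ℝ :=
  weight O α ε j fun l => h (Fin.castLE j.isLt.le l)

/-- The sum over the rounds of a run of a function of the weights and the data of the round. -/
noncomputable def runSum (g : (Fin k → ℝ) → RoundData X k nS nT → ℝ) {r : ℕ}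
    (h : Fin r → RoundData X k nS nT) : ℝ :=
  ∑ j, g (weightAt O α ε h j) (h j)

lemma weightAt_castSucc {r : ℕ} (h : Fin (r + 1) → RoundData X k nS nT) (j : Fin r) :
    weightAt O α ε h j.castSucc = weightAt O α ε (fun l => h l.castSucc) j := rfl

lemma weightAt_last {r : ℕ} (h : Fin (r + 1) → RoundData X k nS nT) :
    weightAt O α ε h (Fin.last r) = weight O α ε r fun l => h l.castSucc := rfl

lemma runSum_succ (g : (Fin k → ℝ) → RoundData X k nS nT → ℝ) {r : ℕ}
    (h : Fin (r + 1) → RoundData X k nS nT) :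
    runSum O α ε g h = runSum O α ε g (fun l => h l.castSucc) +
      g (weight O α ε r fun l => h l.castSucc) (h (Fin.last r)) := by
  simp only [runSum, Fin.sum_univ_castSucc, weightAt_castSucc, weightAt_last]

lemma runSum_snoc (g : (Fin k → ℝ) → RoundData X k nS nT → ℝ) {r : ℕ}
    (h : Fin r → RoundData X k nS nT) (R : RoundData X k nS nT) :
    runSum O α ε g (Fin.snoc (α := fun _ => RoundData X k nS nT) h R :
      Fin (r + 1) → RoundData X k nS nT) =
      runSum O α ε g h + g (weight O α ε r h) R := by
  rw [runSum_succ]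
  simp

lemma exists_round_snoc (B : (Fin k → ℝ) → Set (RoundData X k nS nT)) {r : ℕ}
    (h : Fin r → RoundData X k nS nT) (R : RoundData X k nS nT) :
    (∃ j, (Fin.snoc (α := fun _ => RoundData X k nS nT) h R :
        Fin (r + 1) → RoundData X k nS nT) j ∈ B (weightAt O α ε (Fin.snoc
          (α := fun _ => RoundData X k nS nT) h R : Fin (r + 1) → RoundData X k nS nT) j)) ↔
      (∃ j, h j ∈ B (weightAt O α ε h j)) ∨ R ∈ B (weight O α ε r h) := by
  rw [Fin.exists_fin_succ']
  simp only [weightAt_castSucc, weightAt_last, Fin.snoc_castSucc, Fin.snoc_last]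

end Weights

/-! ### Measurability of scores, weights and run sums -/

section Measurability

variable {X : Type*} [MeasurableSpace X] {k nS nT : ℕ} {O : LearningRule X} (α ε : ℝ)

lemma measurable_empErr {Y : Type*} [MeasurableSpace Y] {n : ℕ}
    {f : Y → X → Bool} (hf : Measurable fun p : Y × X => f p.1 p.2) {S : Y → Fin n → X × Bool}
    (hS : Measurable S) : Measurable fun y => empErr (S y) (f y) := by
  simp_rw [empErr_eq]
  exact ((measurable_hits_errSet hf).comp (measurable_id.prodMk hS)).div_const _

lemma measurable_rule_fst (hO : IsMeasurableRule O) :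
    Measurable fun p : RoundData X k nS nT × X => O nS p.1.1 p.2 :=
  (hO nS).comp (by fun_prop : Measurable fun p : RoundData X k nS nT × X => (p.1.1, p.2))

lemma measurable_score (hO : IsMeasurableRule O) (i : Fin k) :
    Measurable fun R : RoundData X k nS nT => score O α ε R i := by
  have h1 := measurable_empErr (f := fun R : RoundData X k nS nT => O nS R.1)
    (measurable_rule_fst hO) (S := fun R => R.2 i) (by fun_prop)
  have h2 := measurable_empErr (f := fun R : RoundData X k nS nT => O nS R.1)
    (measurable_rule_fst hO) (S := fun R => R.1) (by fun_prop)
  unfold score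
  fun_prop

lemma measurable_weight (hO : IsMeasurableRule O) (r : ℕ) :
    Measurable fun h : Fin r → RoundData X k nS nT => weight O α ε r h := by
  rw [measurable_pi_iff]
  intro i
  induction r with
  | zero => simp [weight]
  | succ r ih =>
    simp only [weight]
    have h1 := ih.comp (by fun_prop : Measurable
      fun (h : Fin (r + 1) → RoundData X k nS nT) (j : Fin r) => h j.castSucc)
    have h2 := (measurable_score (nS := nS) (nT := nT) α ε hO i).comp
      (measurable_pi_apply (X := fun _ : Fin (r + 1) => RoundData X k nS nT) (Fin.last r))
    simp only [Function.comp_def] at h1 h2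
    exact h1.mul (h2.const_add 1)

lemma measurable_weightAt (hO : IsMeasurableRule O) {r : ℕ} (j : Fin r) :
    Measurable fun h : Fin r → RoundData X k nS nT => weightAt O α ε h j :=
  (measurable_weight α ε hO j).comp (by fun_prop)

lemma measurable_runSum (hO : IsMeasurableRule O) {g : (Fin k → ℝ) → RoundData X k nS nT → ℝ}
    (hg : Measurable fun q : (Fin k → ℝ) × RoundData X k nS nT => g q.1 q.2) (r : ℕ) :
    Measurable fun h : Fin r → RoundData X k nS nT => runSum O α ε g h :=
  Finset.measurable_sum _ fun j _ =>
    hg.comp ((measurable_weightAt α ε hO j).prodMk (measurable_pi_apply j))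

lemma measurableSet_exists_round (hO : IsMeasurableRule O)
    {B : (Fin k → ℝ) → Set (RoundData X k nS nT)}
    (hB : MeasurableSet {q : (Fin k → ℝ) × RoundData X k nS nT | q.2 ∈ B q.1}) (r : ℕ) :
    MeasurableSet {h : Fin r → RoundData X k nS nT | ∃ j, h j ∈ B (weightAt O α ε h j)} := by
  have : {h : Fin r → RoundData X k nS nT | ∃ j, h j ∈ B (weightAt O α ε h j)} =
      ⋃ j, (fun h => (weightAt O α ε h j, h j)) ⁻¹'
        {q : (Fin k → ℝ) × RoundData X k nS nT | q.2 ∈ B q.1} := by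
    ext h; simp
  rw [this]
  exact MeasurableSet.iUnion fun j =>
    ((measurable_weightAt α ε hO j).prodMk (measurable_pi_apply j)) hB

lemma measurable_snoc {Z : Type*} [MeasurableSpace Z] (r : ℕ) :
    Measurable fun q : (Fin r → Z) × Z =>
      (Fin.snoc (α := fun _ => Z) q.1 q.2 : Fin (r + 1) → Z) := by
  rw [measurable_pi_iff]
  intro j
  refine Fin.lastCases ?_ (fun j => ?_) j
  · simp only [Fin.snoc_last]; fun_prop
  · simp only [Fin.snoc_castSucc]; fun_prop

end Measurability

/-! ### The law of a run: supermartingale tail and union bound -/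

section Laws

variable {X : Type*} [MeasurableSpace X] {k : ℕ} (D : Fin k → Measure (X × Bool))
  [∀ i, IsProbabilityMeasure (D i)]

/-- The error on the mixture with weights `w`. -/
noncomputable def mixErr {X : Type*} [MeasurableSpace X] {k : ℕ} (w : Fin k → ℝ)
    (D : Fin k → Measure (X × Bool)) (f : X → Bool) : ℝ :=
  ∑ i, w i / (∑ j, w j) * err (D i) f

lemma sum_div_sum_eq_one {w : Fin k → ℝ} (hk : 0 < k) (hw : ∀ i, 0 < w i) :
    ∑ i, w i / ∑ j, w j = 1 := by
  rw [← Finset.sum_div, div_self]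
  have : Nonempty (Fin k) := ⟨⟨0, hk⟩⟩
  exact (Finset.sum_pos (fun i _ => hw i) Finset.univ_nonempty).ne'

lemma div_sum_nonneg {w : Fin k → ℝ} (hw : ∀ i, 0 < w i) (i : Fin k) :
    0 ≤ w i / ∑ j, w j :=
  div_nonneg (hw i).le (Finset.sum_nonneg fun j _ => (hw j).le)

lemma isProbabilityMeasure_mixture {w : Fin k → ℝ} (hk : 0 < k) (hw : ∀ i, 0 < w i) :
    IsProbabilityMeasure (mixture w D) := by
  constructor
  simp only [mixture, Measure.coe_finsetSum, Finset.sum_apply, Measure.smul_apply,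
    measure_univ, smul_eq_mul, mul_one]
  rw [← ENNReal.ofReal_sum_of_nonneg fun i _ => div_sum_nonneg hw i, sum_div_sum_eq_one hk hw,
    ENNReal.ofReal_one]

lemma err_mixture {w : Fin k → ℝ} (hw : ∀ i, 0 < w i) (f : X → Bool) :
    err (mixture w D) f = mixErr w D f := by
  simp only [err, mixErr, mixture, Measure.real, Measure.coe_finsetSum, Finset.sum_apply,
    Measure.smul_apply, smul_eq_mul]
  rw [ENNReal.toReal_sum fun i _ => ENNReal.mul_ne_top ENNReal.ofReal_ne_top (measure_ne_top _ _)]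
  refine Finset.sum_congr rfl fun i _ => ?_
  rw [ENNReal.toReal_mul, ENNReal.toReal_ofReal (div_sum_nonneg hw i)]

lemma isProbabilityMeasure_roundLaw {w : Fin k → ℝ} (hk : 0 < k) (hw : ∀ i, 0 < w i)
    (nS nT : ℕ) : IsProbabilityMeasure (roundLaw nS nT D w) := by
  have := isProbabilityMeasure_mixture D hk hw
  unfold roundLaw
  infer_instance

lemma measurable_roundLaw {Y : Type*} [MeasurableSpace Y] {w : Y → Fin k → ℝ} (hk : 0 < k)
    (hw : ∀ y i, 0 < w y i) (hwm : Measurable w) (nS nT : ℕ) :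
    Measurable fun y => roundLaw nS nT D (w y) := by
  have hmix := fun y => isProbabilityMeasure_mixture D hk (hw y)
  have h1 : ∀ s, MeasurableSet s → Measurable fun y => mixture (w y) D s := by
    intro s _
    simp only [mixture, Measure.coe_finsetSum, Finset.sum_apply, Measure.smul_apply, smul_eq_mul]
    fun_prop
  have h2 : Measurable fun y => Measure.pi fun _ : Fin nS => mixture (w y) D := by
    refine Measurable.measure_of_isPiSystem_of_isProbabilityMeasure generateFrom_pi.symm
      isPiSystem_pi ?_
    rintro _ ⟨s, hs, rfl⟩
    simp only [Measure.pi_pi]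
    exact Finset.measurable_prod _ fun j _ => h1 _ (hs j (Set.mem_univ j))
  have := fun y => isProbabilityMeasure_roundLaw D hk (hw y) nS nT
  refine Measurable.measure_of_isPiSystem_of_isProbabilityMeasure generateFrom_prod.symm
    isPiSystem_prod ?_
  rintro _ ⟨s, hs, t, ht, rfl⟩
  simp only [roundLaw, Measure.prod_prod]
  exact ((Measure.measurable_coe (show MeasurableSet s from hs)).comp h2).mul_const _

variable {α ε : ℝ} {nS nT : ℕ} {O : LearningRule X}

lemma isProbabilityMeasure_runLaw (hk : 0 < k) (hα : 0 < α) (hε : 0 < ε)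
    (hO : IsMeasurableRule O) (r : ℕ) :
    IsProbabilityMeasure (runLaw nS nT O α ε D r) := by
  induction r with
  | zero => rw [runLaw]; infer_instance
  | succ r ih =>
    have hw := weight_pos (k := k) (nS := nS) (nT := nT) O hα hε r
    have hprob := fun h => isProbabilityMeasure_roundLaw D hk (hw h) nS nT
    have hm := measurable_roundLaw D hk hw (measurable_weight α ε hO r) nS nT
    let κ : ProbabilityTheory.Kernel (Fin r → RoundData X k nS nT) (RoundData X k nS nT) :=
      ⟨_, hm⟩
    have : ProbabilityTheory.IsMarkovKernel κ := ⟨hprob⟩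
    have hsn := measurable_snoc (Z := RoundData X k nS nT) r
    have hsn' := fun h : Fin r → RoundData X k nS nT => hsn.comp (measurable_prodMk_left (x := h))
    simp only [Function.comp_def] at hsn'
    have hmm : Measurable fun h : Fin r → RoundData X k nS nT =>
        (roundLaw nS nT D (weight O α ε r h)).map fun R =>
        (Fin.snoc (α := fun _ => RoundData X k nS nT) h R :
          Fin (r + 1) → RoundData X k nS nT) := by
      refine Measure.measurable_of_measurable_coe _ fun s hs => ?_
      have h1 := ProbabilityTheory.Kernel.measurable_kernel_prodMk_left (κ := κ) (hsn hs)
      convert h1 using 2 with h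
      rw [Measure.map_apply (hsn' h) hs]
      rfl
    constructor
    rw [runLaw, Measure.bind_apply MeasurableSet.univ hmm.aemeasurable]
    have h3 : ∀ h : Fin r → RoundData X k nS nT,
        ((roundLaw nS nT D (weight O α ε r h)).map fun R =>
        (Fin.snoc (α := fun _ => RoundData X k nS nT) h R :
          Fin (r + 1) → RoundData X k nS nT)) Set.univ = 1 := by
      intro h
      rw [Measure.map_apply (hsn' h) MeasurableSet.univ, Set.preimage_univ]
      exact (hprob h).measure_univ
    simp [h3]

/-- If the exponential moment of `g` in every round is at most `1`, the sum of `g` over the rounds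
has an exponential tail. -/
lemma runLaw_lt_runSum_le (hk : 0 < k) (hα : 0 < α) (hε : 0 < ε) (hO : IsMeasurableRule O)
    {g : (Fin k → ℝ) → RoundData X k nS nT → ℝ}
    (hg : Measurable fun q : (Fin k → ℝ) × RoundData X k nS nT => g q.1 q.2)
    (h1 : ∀ w, (∀ i, 0 < w i) →
      ∫⁻ R, ENNReal.ofReal (Real.exp (g w R)) ∂(roundLaw nS nT D w) ≤ 1) (r : ℕ) (u : ℝ) :
    runLaw nS nT O α ε D r {h | u < runSum O α ε g h} ≤ ENNReal.ofReal (Real.exp (-u)) := by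
  -- Supermartingale property: given the past, the factor contributed by the new round has mean at
  -- most 1.
  have key : ∫⁻ h, ENNReal.ofReal (Real.exp (runSum O α ε g h)) ∂(runLaw nS nT O α ε D r) ≤
      ENNReal.ofReal 1 := by
    induction r with
    | zero =>
      have := isProbabilityMeasure_runLaw D (nS := nS) (nT := nT) hk hα hε hO 0
      simp [runSum]
    | succ r ih =>
      rw [runLaw]
      refine (Measure.lintegral_bind_le _ _ _).trans (le_trans (lintegral_mono fun h => ?_) ih)
      refine (lintegral_map_le _ _).trans ?_
      simp_rw [runSum_snoc, Real.exp_add, ENNReal.ofReal_mul (Real.exp_pos _).le]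
      rw [lintegral_const_mul']
      · calc _ ≤ ENNReal.ofReal (Real.exp (runSum O α ε g h)) * 1 := by
              gcongr
              exact h1 _ (weight_pos O hα hε r h)
          _ = _ := mul_one _
      · exact ENNReal.ofReal_ne_top
  simpa using meas_lt_le_of_lintegral_exp_le _ (measurable_runSum α ε hO hg r) key u

/-- The union bound over the rounds. -/
lemma runLaw_exists_round_le (hk : 0 < k) (hα : 0 < α) (hε : 0 < ε) (hO : IsMeasurableRule O)
    {B : (Fin k → ℝ) → Set (RoundData X k nS nT)}
    (hB : MeasurableSet {q : (Fin k → ℝ) × RoundData X k nS nT | q.2 ∈ B q.1}) {p : ENNReal}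
    (hp : ∀ w, (∀ i, 0 < w i) → roundLaw nS nT D w (B w) ≤ p) (r : ℕ) :
    runLaw nS nT O α ε D r {h | ∃ j, h j ∈ B (weightAt O α ε h j)} ≤ r * p := by
  induction r with
  | zero => simp
  | succ r ih =>
    have hm := measurableSet_exists_round α ε hO hB
    have hprob := isProbabilityMeasure_runLaw D (nS := nS) (nT := nT) hk hα hε hO r
    rw [runLaw]
    refine (Measure.bind_apply_le _ (hm (r + 1))).trans ?_
    -- Either the past already contains a bad round, and the indicator pays for it, or only the new
    -- round can be bad, at cost p.
    have hstep : ∀ h : Fin r → RoundData X k nS nT,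
        ((roundLaw nS nT D (weight O α ε r h)).map fun R =>
          (Fin.snoc (α := fun _ => RoundData X k nS nT) h R :
            Fin (r + 1) → RoundData X k nS nT))
          {h | ∃ j, h j ∈ B (weightAt O α ε h j)} ≤
        Set.indicator {h | ∃ j, h j ∈ B (weightAt O α ε h j)} 1 h + p := by
      intro h
      have hsn := (measurable_snoc (Z := RoundData X k nS nT) r).comp
        (measurable_prodMk_left (x := h))
      simp only [Function.comp_def] at hsn
      rw [Measure.map_apply hsn (hm (r + 1))]
      by_cases hh : ∃ j, h j ∈ B (weightAt O α ε h j)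
      · have := isProbabilityMeasure_roundLaw D hk
          (weight_pos (k := k) (nS := nS) (nT := nT) O hα hε r h) nS nT
        rw [Set.indicator_of_mem (by exact hh)]
        exact prob_le_one.trans le_self_add
      · rw [Set.indicator_of_notMem (by exact hh), zero_add]
        refine le_trans (measure_mono fun R hR => ?_) (hp _ (weight_pos O hα hε r h))
        exact ((exists_round_snoc O α ε B h R).1 hR).resolve_left hh
    refine (lintegral_mono hstep).trans ?_
    rw [lintegral_add_right _ measurable_const, lintegral_indicator_one (hm r), lintegral_const,
      measure_univ, mul_one]
    push_cast
    rw [add_mul, one_mul]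
    gcongr

end Laws

/-! ### Scalar exponential inequalities -/

lemma exp_sub_one_le {a θ : ℝ} (h0 : 0 ≤ θ) (h : θ ≤ a) (ha : a ≤ 1) :
    Real.exp θ - 1 ≤ θ * (1 + a) := by
  have h1 := Real.abs_exp_sub_one_sub_id_le (x := θ) (by rw [abs_le]; constructor <;> linarith)
  nlinarith [(abs_le.1 h1).2]

lemma exp_neg_sub_one_le {a θ : ℝ} (h0 : 0 ≤ θ) (h : θ ≤ a) (ha : a ≤ 1) :
    Real.exp (-θ) - 1 ≤ -(θ * (1 - a)) := by
  have h1 := Real.abs_exp_sub_one_sub_id_le (x := -θ) (by rw [abs_le]; constructor <;> linarith)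
  nlinarith [(abs_le.1 h1).2]

/-- The left side bounds the moment of a capped increment, because e^{-l min(Y,a)} ≤ e^{-lY} +
e^{-la}. The cost of the second summand is absorbed by the coefficient 12/5 if the capped mean is at
least a/2, and by the term a³ otherwise. -/
lemma exp_neg_add_exp_neg_le {a l x : ℝ} (ha : 0 < a) (ha1 : a ≤ 1 / 35) (hl : 1 ≤ l * a ^ 2)
    (hx : 0 ≤ x) :
    Real.exp (-(l * x * (1 - a))) + Real.exp (-(l * a)) ≤
      Real.exp (-(l * ((1 - 12 / 5 * a) * min x a - a ^ 3))) := by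
  have hl0 : 0 < l := by
    by_contra h
    nlinarith [sq_nonneg a]
  set m := min x a with hm
  have hmx : m ≤ x := min_le_left _ _
  have hma : m ≤ a := min_le_right _ _
  have hm0 : 0 ≤ m := le_min hx ha.le
  have h1a : 0 ≤ 1 - a := by linarith
  have h1 : Real.exp (-(l * x * (1 - a))) ≤ Real.exp (-(l * m * (1 - a))) := by
    apply Real.exp_le_exp.2
    have : l * m ≤ l * x := by gcongr
    nlinarith
  have h35 : (35 : ℝ) ≤ 1 / a := by
    rw [le_div_iff₀ ha]; linarith
  rcases le_or_gt (a / 2) m with h | h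
  · have h2 : Real.exp (-(l * a)) ≤ Real.exp (-(l * m * (1 - a))) := by
      apply Real.exp_le_exp.2
      have : l * m ≤ l * a := by gcongr
      have : 0 ≤ l * m := by positivity
      nlinarith
    -- The slack is (12/5 - 1) l a m, which is at least 7/10 because m ≥ a/2 and l a² ≥ 1.
    have h3 : (2 : ℝ) ≤ Real.exp (7 / 10) := by
      rw [← Real.log_le_iff_le_exp (by norm_num)]
      linarith [Real.log_two_lt_d9]
    calc _ ≤ 2 * Real.exp (-(l * m * (1 - a))) := by linarith
      _ ≤ Real.exp (7 / 10) * Real.exp (-(l * m * (1 - a))) := by gcongr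
      _ = Real.exp (7 / 10 - l * m * (1 - a)) := by rw [← Real.exp_add]; ring_nf
      _ ≤ _ := by
        apply Real.exp_le_exp.2
        have h4 : l * a ^ 2 * (1 / 2) ≤ l * a * m := by
          have : l * a * (a / 2) ≤ l * a * m := by gcongr
          nlinarith
        have h5 : 0 ≤ l * a ^ 3 := by positivity
        nlinarith
  · set y := l * a / 2 with hy
    have h2 : Real.exp (-(l * a)) ≤ Real.exp (-(l * m * (1 - a))) * Real.exp (-y) := by
      rw [← Real.exp_add]
      apply Real.exp_le_exp.2
      have : l * m ≤ l * (a / 2) := by gcongr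
      have : 0 ≤ l * m := by positivity
      nlinarith
    -- The quadratic term of e^y suffices: l a³ · y²/2 = (l a²)³/(8a) ≥ 35/8.
    have h3 : Real.exp (-y) ≤ l * a ^ 3 := by
      have hy0 : 0 < y := by positivity
      have h4 := Real.quadratic_le_exp_of_nonneg hy0.le
      have h5 : 1 ≤ l * a ^ 3 * (y ^ 2 / 2) := by
        have h6 : l * a ^ 3 * (y ^ 2 / 2) = (l * a ^ 2) ^ 3 * (1 / a) / 8 := by
          rw [hy]; field_simp; norm_num
        rw [h6]
        have : 1 ≤ (l * a ^ 2) ^ 3 := one_le_pow₀ hl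
        nlinarith
      rw [Real.exp_neg, inv_le_iff_one_le_mul₀ (Real.exp_pos _)]
      have h6 : 0 ≤ l * a ^ 3 := by positivity
      nlinarith
    calc _ ≤ Real.exp (-(l * m * (1 - a))) * (Real.exp (-y) + 1) := by linarith
      _ ≤ Real.exp (-(l * m * (1 - a))) * Real.exp (l * a ^ 3) := by
          gcongr
          exact (by gcongr : Real.exp (-y) + 1 ≤ l * a ^ 3 + 1).trans (Real.add_one_le_exp _)
      _ = Real.exp (l * a ^ 3 - l * m * (1 - a)) := by rw [← Real.exp_add]; ring_nf
      _ ≤ _ := by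
        apply Real.exp_le_exp.2
        have : 0 ≤ l * m * a := by positivity
        nlinarith


/-! ### The scale of the scores -/

section Scale

variable {X : Type*} {k nS nT : ℕ} (O : LearningRule X) (α ε : ℝ)

/-- The factor that turns the error of a player into the increment of its weight. -/
noncomputable def scale (S : Fin nS → X × Bool) : ℝ :=
  aPar α ^ 2 / ((1 + 3 * aPar α) * empErr S (O nS S) + 3 * ePar ε)

lemma score_eq (R : RoundData X k nS nT) (i : Fin k) :
    score O α ε R i = min (scale O α ε R.1 / nT * hits (R.2 i) (errSet (O nS R.1))) (aPar α) := by
  rw [score, scale, empErr_eq]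
  ring_nf

variable {α ε}

lemma scale_pos (hα : 0 < α) (hε : 0 < ε) (S : Fin nS → X × Bool) : 0 < scale O α ε S := by
  have h1 := aPar_pos hα
  have h2 := ePar_pos hε
  have h4 := empErr_nonneg S (O nS S)
  unfold scale
  positivity

lemma scale_le (hα : 0 < α) (hε : 0 < ε) (S : Fin nS → X × Bool) :
    scale O α ε S ≤ aPar α ^ 2 / (3 * ePar ε) := by
  have h1 := aPar_pos hα
  have h2 := ePar_pos hε
  have h4 := empErr_nonneg S (O nS S)
  unfold scale
  gcongr
  have : 0 ≤ (1 + 3 * aPar α) * empErr S (O nS S) := by positivity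
  linarith

/-- Bounds for the rate of the exponential moments per hit. -/
lemma rate_bounds {l : ℝ} (hα : 0 < α) (hε : 0 < ε) (hl : 0 < l) (hnT : 0 < nT)
    (hln : l * aPar α ≤ 3 * ePar ε * nT) (S : Fin nS → X × Bool) :
    0 ≤ l * (scale O α ε S / nT) ∧ l * (scale O α ε S / nT) ≤ aPar α := by
  have h1 := aPar_pos hα
  have h2 := ePar_pos hε
  have h3 := scale_pos O hα hε S
  have h4 : (0 : ℝ) < nT := by exact_mod_cast hnT
  refine ⟨by positivity, ?_⟩
  rw [← mul_div_assoc, div_le_iff₀ h4]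
  calc l * scale O α ε S ≤ l * (aPar α ^ 2 / (3 * ePar ε)) := by
        gcongr; exact scale_le O hα hε S
    _ = aPar α * (l * aPar α) / (3 * ePar ε) := by ring
    _ ≤ aPar α * (3 * ePar ε * nT) / (3 * ePar ε) := by gcongr
    _ = aPar α * nT := by field_simp

end Scale

/-! ### Exponential moments and bad events of one round -/

section Round

variable {X : Type*} [MeasurableSpace X] {k nS nT : ℕ} {O : LearningRule X} {α ε : ℝ}

lemma measurable_scale (hO : IsMeasurableRule O) :
    Measurable fun S : Fin nS → X × Bool => scale O α ε S := by
  have h2 := measurable_empErr (f := fun S : Fin nS → X × Bool => O nS S) (hO nS)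
    (S := fun S => S) measurable_id
  unfold scale
  fun_prop

variable (D : Fin k → Measure (X × Bool)) [∀ i, IsProbabilityMeasure (D i)]

lemma measurable_mixErr_rule (hO : IsMeasurableRule O) :
    Measurable fun q : (Fin k → ℝ) × (Fin nS → X × Bool) => mixErr q.1 D (O nS q.2) := by
  unfold mixErr
  refine Finset.measurable_sum _ fun i _ => ?_
  have : Measurable fun q : (Fin k → ℝ) × (Fin nS → X × Bool) => err (D i) (O nS q.2) :=
    (measurable_err (D i) (hO nS)).comp measurable_snd
  fun_prop

lemma lintegral_exp_hits_player_le {f : X → Bool} (hf : Measurable f) (θ : ℝ) (i : Fin k) :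
    ∫⁻ T, ENNReal.ofReal (Real.exp (θ * hits (T i) (errSet f)))
      ∂(Measure.pi fun i : Fin k => Measure.pi fun _ : Fin nT => D i) ≤
      ENNReal.ofReal (Real.exp (nT * (err (D i) f * (Real.exp θ - 1)))) := by
  have hE := measurableSet_errSet hf
  have hm : Measurable fun T : Fin nT → X × Bool =>
      ENNReal.ofReal (Real.exp (θ * hits T (errSet f))) := by
    have := measurable_hits (n := nT) hE
    fun_prop
  have := (measurePreserving_eval (fun i : Fin k => Measure.pi fun _ : Fin nT => D i) i)
  rw [show (∫⁻ T, ENNReal.ofReal (Real.exp (θ * hits (T i) (errSet f)))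
      ∂(Measure.pi fun i : Fin k => Measure.pi fun _ : Fin nT => D i)) =
      ∫⁻ T, ENNReal.ofReal (Real.exp (θ * hits T (errSet f))) ∂(Measure.pi fun _ : Fin nT => D i)
      from this.lintegral_comp hm]
  exact lintegral_exp_hits_le (D i) hE nT θ

lemma lintegral_roundLaw_le_one {w : Fin k → ℝ} (hk : 0 < k) (hw : ∀ i, 0 < w i)
    {G : RoundData X k nS nT → ENNReal} (hG : Measurable G)
    (h : ∀ S, ∫⁻ T, G (S, T) ∂(Measure.pi fun i : Fin k => Measure.pi fun _ : Fin nT => D i) ≤ 1) :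
    ∫⁻ R, G R ∂(roundLaw nS nT D w) ≤ 1 := by
  have := isProbabilityMeasure_mixture D hk hw
  rw [roundLaw, lintegral_prod _ hG.aemeasurable]
  exact (lintegral_mono h).trans (by simp)

/-- `l` times the excess of the average increment of a round over its bound. -/
noncomputable def avgExcess {X : Type*} [MeasurableSpace X] {k nS nT : ℕ} (O : LearningRule X)
    (α ε : ℝ) (D : Fin k → Measure (X × Bool)) (l : ℝ) (w : Fin k → ℝ)
    (R : RoundData X k nS nT) : ℝ :=
  l * (∑ i, w i / (∑ j, w j) * score O α ε R i -
    (1 + aPar α) * scale O α ε R.1 * mixErr w D (O nS R.1))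

/-- `l` times the shortfall of the increment of player `i` in a round. -/
noncomputable def shortfall {X : Type*} [MeasurableSpace X] {k nS nT : ℕ} (O : LearningRule X)
    (α ε : ℝ) (D : Fin k → Measure (X × Bool)) (l : ℝ) (i : Fin k) (_w : Fin k → ℝ)
    (R : RoundData X k nS nT) : ℝ :=
  l * ((1 - 12 / 5 * aPar α) * min (scale O α ε R.1 * err (D i) (O nS R.1)) (aPar α) -
    aPar α ^ 3 - score O α ε R i)

lemma measurable_avgExcess (hO : IsMeasurableRule O) (l : ℝ) :
    Measurable fun q : (Fin k → ℝ) × RoundData X k nS nT => avgExcess O α ε D l q.1 q.2 := by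
  have h1 := fun i => (measurable_score (k := k) (nS := nS) (nT := nT) α ε hO i)
  have h2 := measurable_scale (nS := nS) (α := α) (ε := ε) hO
  have h3 : Measurable fun q : (Fin k → ℝ) × RoundData X k nS nT => mixErr q.1 D (O nS q.2.1) :=
    (measurable_mixErr_rule (nS := nS) D hO).comp
      (by fun_prop : Measurable fun q : (Fin k → ℝ) × RoundData X k nS nT => (q.1, q.2.1))
  unfold avgExcess
  fun_prop

lemma measurable_shortfall (hO : IsMeasurableRule O) (l : ℝ) (i : Fin k) :
    Measurable fun q : (Fin k → ℝ) × RoundData X k nS nT => shortfall O α ε D l i q.1 q.2 := by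
  have h1 := (measurable_score (k := k) (nS := nS) (nT := nT) α ε hO i)
  have h2 := measurable_scale (nS := nS) (α := α) (ε := ε) hO
  have h3 : Measurable fun q : (Fin k → ℝ) × RoundData X k nS nT => err (D i) (O nS q.2.1) :=
    (measurable_err (D i) (hO nS)).comp
      (by fun_prop : Measurable fun q : (Fin k → ℝ) × RoundData X k nS nT => q.2.1)
  have h4 : Measurable fun q : (Fin k → ℝ) × RoundData X k nS nT => scale O α ε q.2.1 :=
    h2.comp (by fun_prop)
  have h5 := (h4.mul h3).min (measurable_const (a := aPar α))
  unfold shortfall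
  fun_prop

/-- Jensen over the players, with the normalized weights, reduces the claim to a single player, so
averaging costs no factor k. The cap is dropped, and e^θ - 1 ≤ θ(1 + a) for θ ≤ a accounts for the
factor 1 + a in `avgExcess`. -/
lemma lintegral_exp_avgExcess_le_one (hα : 0 < α) (hε : 0 < ε) (ha : aPar α ≤ 1 / 35)
    (hO : IsMeasurableRule O) {l : ℝ} (hl : 0 < l) (hnT : 0 < nT)
    (hln : l * aPar α ≤ 3 * ePar ε * nT) (hk : 0 < k) {w : Fin k → ℝ} (hw : ∀ i, 0 < w i) :
    ∫⁻ R, ENNReal.ofReal (Real.exp (avgExcess O α ε D l w R)) ∂(roundLaw nS nT D w) ≤ 1 := by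
  have hm : Measurable fun R : RoundData X k nS nT =>
      ENNReal.ofReal (Real.exp (avgExcess O α ε D l w R)) :=
    ((measurable_avgExcess D hO l).comp (measurable_prodMk_left (x := w))).exp.ennreal_ofReal
  refine lintegral_roundLaw_le_one D hk hw hm fun S => ?_
  have hω := div_sum_nonneg hw
  have hω1 := sum_div_sum_eq_one hk hw
  set ω : Fin k → ℝ := fun i => w i / ∑ j, w j with hωdef
  set f := O nS S with hf
  set a := aPar α with ha_def
  set c := scale O α ε S with hc
  have ha0 : 0 < a := aPar_pos hα
  have hfm : Measurable f := measurable_of_jointly (hO nS) S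
  have hn0 : (0 : ℝ) < nT := by exact_mod_cast hnT
  obtain ⟨hθ0, hθa⟩ := rate_bounds O hα hε hl hnT hln S
  set θ := l * (c / nT) with hθ
  have hpt : ∀ T : Fin k → Fin nT → X × Bool,
      ENNReal.ofReal (Real.exp (avgExcess O α ε D l w (S, T))) ≤
      ∑ i, ENNReal.ofReal (ω i) * (ENNReal.ofReal (Real.exp (-(l * ((1 + a) * c * err (D i) f)))) *
        ENNReal.ofReal (Real.exp (θ * hits (T i) (errSet f)))) := by
    intro T
    have h1 : avgExcess O α ε D l w (S, T) =
        ∑ i, ω i • (l * (score O α ε (S, T) i - (1 + a) * c * err (D i) f)) := by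
      simp only [avgExcess, mixErr, smul_eq_mul, Finset.mul_sum, ← Finset.sum_sub_distrib]
      refine Finset.sum_congr rfl fun i _ => ?_
      simp only [hωdef, ← hf, ← hc, ← ha_def]
      ring
    have h2 := convexOn_exp.map_sum_le (t := Finset.univ) (w := ω)
      (p := fun i => l * (score O α ε (S, T) i - (1 + a) * c * err (D i) f))
      (fun i _ => hω i) hω1 (fun i _ => Set.mem_univ _)
    rw [h1]
    refine (ENNReal.ofReal_le_ofReal h2).trans ?_
    rw [ENNReal.ofReal_sum_of_nonneg fun i _ => smul_nonneg (hω i) (Real.exp_pos _).le]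
    refine Finset.sum_le_sum fun i _ => ?_
    rw [smul_eq_mul, ENNReal.ofReal_mul (hω i), ← ENNReal.ofReal_mul (Real.exp_pos _).le,
      ← Real.exp_add]
    gcongr
    have h3 : score O α ε (S, T) i ≤ c / nT * hits (T i) (errSet f) := by
      rw [score_eq]; exact min_le_left _ _
    calc l * (score O α ε (S, T) i - (1 + a) * c * err (D i) f) ≤
          l * (c / nT * hits (T i) (errSet f) - (1 + a) * c * err (D i) f) := by gcongr
      _ = _ := by rw [hθ]; ring
  refine (lintegral_mono hpt).trans ?_
  have hmeas : ∀ i, Measurable fun T : Fin k → Fin nT → X × Bool =>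
      ENNReal.ofReal (Real.exp (θ * hits (T i) (errSet f))) := by
    intro i
    have := (measurable_hits (n := nT) (measurableSet_errSet hfm)).comp
      (measurable_pi_apply (X := fun _ : Fin k => Fin nT → X × Bool) i)
    simp only [Function.comp_def] at this
    fun_prop
  rw [lintegral_finsetSum _ fun i _ => ((hmeas i).const_mul _).const_mul _]
  calc _ ≤ ∑ i, ENNReal.ofReal (ω i) := by
        refine Finset.sum_le_sum fun i _ => ?_
        rw [lintegral_const_mul _ ((hmeas i).const_mul _), lintegral_const_mul _ (hmeas i)]
        have h4 : ENNReal.ofReal (Real.exp (-(l * ((1 + a) * c * err (D i) f)))) *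
            ∫⁻ T, ENNReal.ofReal (Real.exp (θ * hits (T i) (errSet f)))
              ∂(Measure.pi fun i : Fin k => Measure.pi fun _ : Fin nT => D i) ≤ 1 := by
          refine (mul_le_mul_right (lintegral_exp_hits_player_le D hfm θ i) _).trans ?_
          rw [← ENNReal.ofReal_mul (Real.exp_pos _).le, ← Real.exp_add, ENNReal.ofReal_le_one,
            Real.exp_le_one_iff]
          have h5 := exp_sub_one_le hθ0 hθa (by linarith)
          have h6 : 0 ≤ err (D i) f := measureReal_nonneg
          have h7 : nT * (err (D i) f * (Real.exp θ - 1)) ≤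
              nT * (err (D i) f * (θ * (1 + a))) := by gcongr
          have h8 : nT * (err (D i) f * (θ * (1 + a))) = l * ((1 + a) * c * err (D i) f) := by
            rw [hθ]; field_simp
          linarith
        calc _ ≤ ENNReal.ofReal (ω i) * 1 := mul_le_mul_right h4 _
          _ = _ := mul_one _
    _ = 1 := by
        rw [← ENNReal.ofReal_sum_of_nonneg fun i _ => hω i, hω1, ENNReal.ofReal_one]

/-- A lower bound on the increment cannot drop the cap. Its moment is split into an uncapped part,
handled by the moment generating function, and e^{-la}; `exp_neg_add_exp_neg_le` recombines them. -/
lemma lintegral_exp_shortfall_le_one (hα : 0 < α) (hε : 0 < ε) (ha : aPar α ≤ 1 / 35)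
    (hO : IsMeasurableRule O) {l : ℝ} (hl : 1 ≤ l * aPar α ^ 2) (hnT : 0 < nT)
    (hln : l * aPar α ≤ 3 * ePar ε * nT) (hk : 0 < k) {w : Fin k → ℝ} (hw : ∀ i, 0 < w i)
    (i : Fin k) :
    ∫⁻ R, ENNReal.ofReal (Real.exp (shortfall O α ε D l i w R)) ∂(roundLaw nS nT D w) ≤ 1 := by
  have hm : Measurable fun R : RoundData X k nS nT =>
      ENNReal.ofReal (Real.exp (shortfall O α ε D l i w R)) :=
    ((measurable_shortfall D hO l i).comp (measurable_prodMk_left (x := w))).exp.ennreal_ofReal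
  refine lintegral_roundLaw_le_one D hk hw hm fun S => ?_
  set f := O nS S with hf
  set a := aPar α with ha_def
  set c := scale O α ε S with hc
  have ha0 : 0 < a := aPar_pos hα
  have hl0 : 0 < l := by
    by_contra h
    nlinarith [sq_nonneg a]
  have hc0 : 0 < c := scale_pos O hα hε S
  have hfm : Measurable f := measurable_of_jointly (hO nS) S
  have hn0 : (0 : ℝ) < nT := by exact_mod_cast hnT
  obtain ⟨hθ0, hθa⟩ := rate_bounds O hα hε hl0 hnT hln S
  set θ := l * (c / nT) with hθ
  have hp0 : 0 ≤ err (D i) f := measureReal_nonneg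
  set K := l * ((1 - 12 / 5 * a) * min (c * err (D i) f) a - a ^ 3) with hK
  have hpt : ∀ T : Fin k → Fin nT → X × Bool,
      ENNReal.ofReal (Real.exp (shortfall O α ε D l i w (S, T))) ≤
      ENNReal.ofReal (Real.exp K) * (ENNReal.ofReal (Real.exp (-θ * hits (T i) (errSet f))) +
        ENNReal.ofReal (Real.exp (-(l * a)))) := by
    intro T
    rw [← ENNReal.ofReal_add (Real.exp_pos _).le (Real.exp_pos _).le,
      ← ENNReal.ofReal_mul (Real.exp_pos _).le]
    apply ENNReal.ofReal_le_ofReal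
    have h1 : shortfall O α ε D l i w (S, T) = K + -(l * score O α ε (S, T) i) := by
      simp only [shortfall, hK, ← hf, ← hc, ← ha_def]
      ring
    rw [h1, Real.exp_add]
    gcongr
    rw [score_eq]
    have e1 := (Real.exp_pos (-θ * hits (T i) (errSet f))).le
    have e2 := (Real.exp_pos (-(l * a))).le
    rcases min_choice (c / nT * hits (T i) (errSet f)) a with h | h
    · simp only [← hc, ← hf, ← ha_def, h]
      rw [show -(l * (c / nT * hits (T i) (errSet f))) = -θ * hits (T i) (errSet f) by
        rw [hθ]; ring]
      linarith
    · simp only [← hc, ← hf, ← ha_def, h]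
      linarith
  refine (lintegral_mono hpt).trans ?_
  rw [lintegral_const_mul' _ _ ENNReal.ofReal_ne_top, lintegral_add_right _ measurable_const]
  simp only [lintegral_const, measure_univ, mul_one]
  refine (mul_le_mul_right (add_le_add_left
    (lintegral_exp_hits_player_le D hfm (-θ) i) _) _).trans ?_
  rw [← ENNReal.ofReal_add (Real.exp_pos _).le (Real.exp_pos _).le,
    ← ENNReal.ofReal_mul (Real.exp_pos _).le, ENNReal.ofReal_le_one]
  have h5 := exp_neg_sub_one_le hθ0 hθa (by linarith)
  have h7 : nT * (err (D i) f * (Real.exp (-θ) - 1)) ≤ -(l * (c * err (D i) f) * (1 - a)) := by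
    calc nT * (err (D i) f * (Real.exp (-θ) - 1)) ≤ nT * (err (D i) f * -(θ * (1 - a))) := by
          gcongr
      _ = _ := by rw [hθ]; field_simp
  have h8 := exp_neg_add_exp_neg_le ha0 ha hl (mul_nonneg hc0.le hp0)
  calc _ ≤ Real.exp K * (Real.exp (-(l * (c * err (D i) f) * (1 - a))) + Real.exp (-(l * a))) := by
        gcongr
    _ ≤ Real.exp K * Real.exp (-K) := by gcongr
    _ = 1 := by rw [← Real.exp_add]; simp

/-- The rounds in which the sample from the mixture misleads: the classifier of the round does much
worse on the mixture than on the sample, or the sample misrepresents the classifier `f₀`. -/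
def badRound {X : Type*} [MeasurableSpace X] {k nS nT : ℕ} (O : LearningRule X)
    (α ε : ℝ) (D : Fin k → Measure (X × Bool)) (f₀ : X → Bool) (θ₀ : ℝ) (w : Fin k → ℝ) :
    Set (RoundData X k nS nT) :=
  {R | (1 + aPar α) * empErr R.1 (O nS R.1) + ePar ε < mixErr w D (O nS R.1) ∨
    (1 + aPar α) * θ₀ + ePar ε < empErr R.1 f₀}

lemma measurableSet_badRound (hO : IsMeasurableRule O) {f₀ : X → Bool} (hf₀ : Measurable f₀)
    (θ₀ : ℝ) : MeasurableSet {q : (Fin k → ℝ) × RoundData X k nS nT |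
      q.2 ∈ badRound O α ε D f₀ θ₀ q.1} := by
  have h1 : Measurable fun q : (Fin k → ℝ) × RoundData X k nS nT =>
      empErr q.2.1 (O nS q.2.1) :=
    measurable_empErr (f := fun q : (Fin k → ℝ) × RoundData X k nS nT => O nS q.2.1)
      ((hO nS).comp (by fun_prop : Measurable
        fun p : ((Fin k → ℝ) × RoundData X k nS nT) × X => (p.1.2.1, p.2)))
      (S := fun q => q.2.1) (by fun_prop)
  have h2 : Measurable fun q : (Fin k → ℝ) × RoundData X k nS nT => empErr q.2.1 f₀ :=
    measurable_empErr (f := fun _ : (Fin k → ℝ) × RoundData X k nS nT => f₀)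
      (hf₀.comp measurable_snd) (S := fun q => q.2.1) (by fun_prop)
  have h3 : Measurable fun q : (Fin k → ℝ) × RoundData X k nS nT => mixErr q.1 D (O nS q.2.1) :=
    (measurable_mixErr_rule (nS := nS) D hO).comp
      (by fun_prop : Measurable fun q : (Fin k → ℝ) × RoundData X k nS nT => (q.1, q.2.1))
  exact (measurableSet_lt (by fun_prop) h3).union (measurableSet_lt measurable_const h2)

lemma roundLaw_badRound_le (hα : 0 < α) (hε : 0 < ε) (ha : aPar α ≤ 1 / 35)
    (he : ePar ε ≤ 1)
    (hO : IsMeasurableRule O) {F : Set (X → Bool)} {d : ℕ}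
    (hd : ∀ A : Finset X, Shatters F A → A.card ≤ d) (hOF : ∀ S, O nS S ∈ F)
    {f₀ : X → Bool} (hf₀ : Measurable f₀) {θ₀ : ℝ} (hθ₀ : ∀ i, err (D i) f₀ ≤ θ₀)
    (hnS : 0 < nS) {δ : ℝ} (hδ : 0 < δ) (hδ1 : δ ≤ 1)
    (hn : 10 * (d * Real.log (20 / (aPar α * ePar ε)) + Real.log (1 / δ)) ≤
      aPar α * ePar ε * nS)
    (hk : 0 < k) {w : Fin k → ℝ} (hw : ∀ i, 0 < w i) :
    roundLaw nS nT D w (badRound O α ε D f₀ θ₀ w) ≤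
      ENNReal.ofReal δ + ENNReal.ofReal δ := by
  set a := aPar α with ha_def
  set e := ePar ε with he_def
  have ha0 : 0 < a := aPar_pos hα
  have he0 : 0 < e := ePar_pos hε
  have hn0 : (0 : ℝ) < nS := by exact_mod_cast hnS
  have hprob := isProbabilityMeasure_mixture D hk hw
  have hae : a * e ≤ 1 := by nlinarith
  have hlogδ : Real.log (1 / δ) = -Real.log δ := by rw [one_div, Real.log_inv]
  have hlogδ0 : Real.log δ ≤ 0 := Real.log_nonpos hδ.le hδ1
  have hlogae : 0 ≤ d * Real.log (20 / (a * e)) := by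
    refine mul_nonneg (Nat.cast_nonneg d) (Real.log_nonneg ?_)
    rw [le_div_iff₀ (by positivity)]
    linarith
  set A : Set (Fin nS → X × Bool) := {S | a / 5 * e * nS <
    a / 5 * (nS * err (mixture w D) (O nS S) - (1 + a) * hits S (errSet (O nS S)))} with hA
  set B : Set (Fin nS → X × Bool) := {S | a * (nS * ((1 + a) * θ₀ + e)) <
    a * hits S (errSet f₀)} with hB
  have hsub : badRound (nT := nT) O α ε D f₀ θ₀ w ⊆ Prod.fst ⁻¹' (A ∪ B) := by
    intro R hR
    rcases hR with h | h
    · left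
      rw [← err_mixture D hw, empErr_eq, ← mul_div_assoc, ← ha_def, ← he_def] at h
      rw [← lt_sub_iff_add_lt', lt_sub_iff_add_lt] at h
      have h2 := mul_lt_mul_of_pos_left h (mul_pos ha0 hn0)
      have h3 : a * nS * (e + (1 + a) * hits R.1 (errSet (O nS R.1)) / nS) =
          a * nS * e + a * (1 + a) * hits R.1 (errSet (O nS R.1)) := by field_simp
      rw [h3] at h2
      simp only [hA, Set.mem_ofPred_eq]
      linarith
    · right
      rw [empErr_eq, lt_div_iff₀ hn0] at h
      simp only [hB, Set.mem_ofPred_eq]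
      have := mul_lt_mul_of_pos_left h ha0
      linarith
  have hmix : ∀ s : Set (Fin nS → X × Bool), roundLaw nS nT D w (Prod.fst ⁻¹' s) =
      (Measure.pi fun _ : Fin nS => mixture w D) s := by
    intro s
    rw [roundLaw, ← Set.prod_univ, Measure.prod_prod, measure_univ, mul_one]
  refine (measure_mono hsub).trans ?_
  rw [hmix]
  refine (measure_union_le _ _).trans (add_le_add ?_ ?_)
  -- With τ = a/5 and x = ae/20 the exponent -(a/5)e nS + 2x nS equals -(ae/10) nS, while x⁻ᵈ
  -- contributes d ln(20/(ae)). This is the form of `hn`.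
  · have h1 := lintegral_exp_err_sub_le (mixture w D) hd hOF (hO nS) (γ := a) (τ := a / 5)
      (x := a * e / 20) ha0.le (by linarith) (by positivity) (by linarith) (by positivity)
      (by linarith)
    have hm : Measurable fun S : Fin nS → X × Bool =>
        a / 5 * (nS * err (mixture w D) (O nS S) - (1 + a) * hits S (errSet (O nS S))) := by
      have h2 := measurable_err (mixture w D) (hO nS)
      have h3 : Measurable fun S : Fin nS → X × Bool => hits S (errSet (O nS S)) :=
        (measurable_hits_errSet (hO nS)).comp (measurable_id.prodMk measurable_id)
      fun_prop
    refine (meas_lt_le_of_lintegral_exp_le _ hm h1 _).trans (ENNReal.ofReal_le_ofReal ?_)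
    have h4 : ((a * e / 20)⁻¹) ^ d = Real.exp (d * Real.log (20 / (a * e))) := by
      rw [Real.exp_nat_mul, Real.exp_log (by positivity), inv_div]
    rw [h4, ← Real.exp_add, ← Real.exp_add]
    rw [← Real.le_log_iff_exp_le hδ]
    rw [hlogδ] at hn
    linarith
  · have hE := measurableSet_errSet hf₀
    -- Chernoff at rate a: since e^a - 1 ≤ a(1 + a), the part with θ₀ cancels and e^{-a e nS}
    -- remains.
    have h1 := lintegral_exp_hits_le (mixture w D) hE nS a
    have hm : Measurable fun S : Fin nS → X × Bool => a * hits S (errSet f₀) :=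
      (measurable_hits hE).const_mul _
    refine (meas_lt_le_of_lintegral_exp_le _ hm h1 _).trans (ENNReal.ofReal_le_ofReal ?_)
    rw [← Real.exp_add]
    rw [← Real.le_log_iff_exp_le hδ]
    have h2 : (mixture w D).real (errSet f₀) ≤ θ₀ := by
      have h3 : (mixture w D).real (errSet f₀) = mixErr w D f₀ := err_mixture D hw f₀
      rw [h3, mixErr]
      calc _ ≤ ∑ i, w i / (∑ j, w j) * θ₀ :=
            Finset.sum_le_sum fun i _ => mul_le_mul_of_nonneg_left (hθ₀ i) (div_sum_nonneg hw i)
        _ = θ₀ := by rw [← Finset.sum_mul, sum_div_sum_eq_one hk hw, one_mul]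
    have h0 : 0 ≤ (mixture w D).real (errSet f₀) := measureReal_nonneg
    have h5 := exp_sub_one_le ha0.le le_rfl (by linarith)
    have h6 : nS * ((mixture w D).real (errSet f₀) * (Real.exp a - 1)) ≤
        nS * (θ₀ * (a * (1 + a))) := by
      have : 0 ≤ θ₀ := h0.trans h2
      have : 0 ≤ Real.exp a - 1 := by linarith [Real.one_le_exp ha0.le]
      gcongr
    rw [hlogδ] at hn
    nlinarith

end Round

/-! ### Growth of the weights -/

section Potential

variable {X : Type*} {k nS nT : ℕ} (O : LearningRule X) {α ε : ℝ}

/-- The increments of the players, averaged with the weights `w`. -/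
noncomputable def avgScore {X : Type*} {k nS nT : ℕ} (O : LearningRule X) (α ε : ℝ)
    (w : Fin k → ℝ) (R : RoundData X k nS nT) : ℝ :=
  ∑ i, w i / (∑ j, w j) * score O α ε R i

/-- Each round multiplies Φ by 1 plus the average increment, and ln(1 + x) ≤ x. -/
lemma log_sum_weight_le (hk : 0 < k) (hα : 0 < α) (hε : 0 < ε) {r : ℕ}
    (h : Fin r → RoundData X k nS nT) :
    Real.log (∑ i, weight O α ε r h i) ≤ Real.log k + runSum O α ε (avgScore O α ε) h := by
  induction r with
  | zero => simp [weight, runSum]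
  | succ r ih =>
    set w := weight O α ε r fun j => h j.castSucc with hw
    have hwpos : ∀ i, 0 < w i := weight_pos O hα hε r _
    have : Nonempty (Fin k) := ⟨⟨0, hk⟩⟩
    have hΦ : 0 < ∑ i, w i := Finset.sum_pos (fun i _ => hwpos i) Finset.univ_nonempty
    have havg : 0 ≤ avgScore O α ε w (h (Fin.last r)) :=
      Finset.sum_nonneg fun i _ => mul_nonneg (div_nonneg (hwpos i).le hΦ.le)
        (score_nonneg O hα hε _ i)
    have h1 : ∑ i, weight O α ε (r + 1) h i =
        (∑ i, w i) * (1 + avgScore O α ε w (h (Fin.last r))) := by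
      simp only [weight, ← hw, mul_add, mul_one, Finset.sum_add_distrib, avgScore, Finset.mul_sum]
      congr 1
      refine Finset.sum_congr rfl fun i _ => ?_
      field_simp
    rw [h1, Real.log_mul hΦ.ne' (by positivity), runSum_succ]
    have h2 := Real.log_le_sub_one_of_pos (show 0 < 1 + avgScore O α ε w (h (Fin.last r)) by
      positivity)
    have h3 := ih fun j => h j.castSucc
    simp only [← hw] at h3 ⊢
    linarith

/-- The cap keeps 0 ≤ s ≤ a, where ln(1 + s) ≥ 2s/(s + 2) ≥ (1 - a/2)s. -/
lemma runSum_score_le_log_weight (hα : 0 < α) (hε : 0 < ε) (ha : aPar α ≤ 1 / 35)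
    {r : ℕ} (h : Fin r → RoundData X k nS nT) (i : Fin k) :
    (1 - aPar α / 2) * runSum O α ε (fun _ R => score O α ε R i) h ≤
      Real.log (weight O α ε r h i) := by
  induction r with
  | zero => simp [weight, runSum]
  | succ r ih =>
    have h0 := score_nonneg O hα hε (h (Fin.last r)) i
    have h1 := score_le O α ε (h (Fin.last r)) i
    have h2 := ih fun j => h j.castSucc
    have h3 := Real.le_log_one_add_of_nonneg h0
    have ha0 := aPar_pos hα
    rw [weight, Real.log_mul (weight_pos O hα hε r _ i).ne' (by positivity), runSum_succ]
    set s := score O α ε (h (Fin.last r)) i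
    have h4 : (1 - aPar α / 2) * s ≤ 2 * s / (s + 2) := by
      rw [le_div_iff₀ (by positivity)]
      have : (1 - aPar α / 2) * (s + 2) ≤ 2 := by nlinarith
      nlinarith
    linarith

end Potential

/-! ### The truncated errors of a player on a good run -/

section Deterministic

variable {X : Type*} [MeasurableSpace X] {k nS nT : ℕ} {O : LearningRule X} {α ε : ℝ}
  (D : Fin k → Measure (X × Bool))

/-- The denominator of the score is built for this: (1 + a)((1 + a)x + e) ≤ (1 + 3a)x + 3e. -/
lemma scale_mul_mixErr_le (hα : 0 < α) (hε : 0 < ε) (ha : aPar α ≤ 1 / 35) {f₀ : X → Bool}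
    {θ₀ : ℝ} {w : Fin k → ℝ} {R : RoundData X k nS nT} (hR : R ∉ badRound O α ε D f₀ θ₀ w) :
    (1 + aPar α) * scale O α ε R.1 * mixErr w D (O nS R.1) ≤ aPar α ^ 2 := by
  have ha0 := aPar_pos hα
  have he0 := ePar_pos hε
  have h1 : mixErr w D (O nS R.1) ≤ (1 + aPar α) * empErr R.1 (O nS R.1) + ePar ε :=
    not_lt.1 fun h => hR (Or.inl h)
  have h0 := empErr_nonneg R.1 (O nS R.1)
  unfold scale
  set x := empErr R.1 (O nS R.1)
  have hq : 0 < (1 + 3 * aPar α) * x + 3 * ePar ε := by positivity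
  rw [mul_div_assoc', div_mul_eq_mul_div, div_le_iff₀ hq]
  have h2 : (1 + aPar α) * mixErr w D (O nS R.1) ≤ (1 + 3 * aPar α) * x + 3 * ePar ε := by
    calc _ ≤ (1 + aPar α) * ((1 + aPar α) * x + ePar ε) := by gcongr
      _ ≤ _ := by
        have : aPar α * (aPar α * x) ≤ 1 * (aPar α * x) := by gcongr; linarith
        nlinarith
  have := mul_le_mul_of_nonneg_left h2 (sq_nonneg (aPar α))
  linarith

/-- If no round is bad and the deviations are small, then on average over the rounds the truncated
error of a player is hardly larger than the bound on the error on the mixture. -/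
lemma sum_truncated_err_le (hk : 0 < k) (hα : 0 < α) (hε : 0 < ε) (ha : aPar α ≤ 1 / 35)
    {f₀ : X → Bool} {θ₀ l u : ℝ} (hl : 0 < l) {t : ℕ} {h : Fin t → RoundData X k nS nT}
    (hgood : ∀ j, h j ∉ badRound O α ε D f₀ θ₀ (weightAt O α ε h j))
    (havg : runSum O α ε (avgExcess O α ε D l) h ≤ l * u) {i : Fin k}
    (hshort : runSum O α ε (shortfall O α ε D l i) h ≤ l * u)
    (hku : Real.log k ≤ aPar α ^ 3 * t / 2) (hu : u ≤ aPar α ^ 3 * t / 2) :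
    ∑ j, min (scale O α ε (h j).1 * err (D i) (O nS (h j).1)) (aPar α) ≤
      aPar α ^ 2 * t * (1 + 7 * aPar α) := by
  have ha0 := aPar_pos hα
  set a := aPar α with ha_def
  set M := ∑ j, min (scale O α ε (h j).1 * err (D i) (O nS (h j).1)) a with hM
  set sc := runSum O α ε (fun _ R => score O α ε R i) h with hs
  have h1 : runSum O α ε (avgScore O α ε) h ≤ a ^ 2 * t + u := by
    have e1 : runSum O α ε (avgExcess O α ε D l) h = l * (runSum O α ε (avgScore O α ε) h -
        ∑ j, (1 + a) * scale O α ε (h j).1 *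
          mixErr (weightAt O α ε h j) D (O nS (h j).1)) := by
      simp only [runSum, avgExcess, avgScore, ← Finset.sum_sub_distrib, Finset.mul_sum, ha_def]
    rw [e1] at havg
    have e2 := le_of_mul_le_mul_left havg hl
    have e3 : ∑ j, (1 + a) * scale O α ε (h j).1 *
          mixErr (weightAt O α ε h j) D (O nS (h j).1) ≤ ∑ _j : Fin t, a ^ 2 :=
      Finset.sum_le_sum fun j _ => scale_mul_mixErr_le D hα hε ha (hgood j)
    simp only [Finset.sum_const, Finset.card_univ, Fintype.card_fin, nsmul_eq_mul] at e3
    linarith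
  have h2 : (1 - 12 / 5 * a) * M - a ^ 3 * t - u ≤ sc := by
    have e1 : runSum O α ε (shortfall O α ε D l i) h =
        l * ((1 - 12 / 5 * a) * M - a ^ 3 * t - sc) := by
      simp only [runSum, shortfall, hM, hs, ← Finset.mul_sum, Finset.sum_sub_distrib, ← ha_def,
        Finset.sum_const, Finset.card_univ, Fintype.card_fin, nsmul_eq_mul]
      ring
    rw [e1] at hshort
    have e2 := le_of_mul_le_mul_left hshort hl
    linarith
  have h3 : (1 - a / 2) * sc ≤ Real.log k + a ^ 2 * t + u := by
    have e1 := runSum_score_le_log_weight O hα hε ha h i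
    have e2 := log_sum_weight_le O hk hα hε h
    have e3 : Real.log (weight O α ε t h i) ≤ Real.log (∑ i, weight O α ε t h i) :=
      Real.log_le_log (weight_pos O hα hε t h i)
        (Finset.single_le_sum (fun i _ => (weight_pos O hα hε t h i).le) (Finset.mem_univ i))
    linarith
  have hM0 : 0 ≤ M := Finset.sum_nonneg fun j _ =>
    le_min (mul_nonneg (scale_pos O hα hε _).le measureReal_nonneg) ha0.le
  have hT : (0 : ℝ) ≤ a ^ 2 * t := by positivity
  set T := a ^ 2 * t with hTdef
  have h4 : a ^ 3 * t = a * T := by rw [hTdef]; ring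
  rw [h4] at h2 hku hu
  have h5 : (1 - a / 2) * ((1 - 12 / 5 * a) * M - 3 / 2 * (a * T)) ≤ T * (1 + a) := by
    have : (1 - a / 2) * ((1 - 12 / 5 * a) * M - 3 / 2 * (a * T)) ≤ (1 - a / 2) * sc := by
      gcongr
      · linarith
      · linarith
    linarith
  -- Here 29/10 = 1/2 + 12/5 and 5/2 = 1 + 3/2. In the next step 7a leaves room for the quadratic
  -- term because a ≤ 1/35.
  have h6 : (1 - 29 / 10 * a) * M ≤ T * (1 + 5 / 2 * a) := by
    have e1 : 0 ≤ a * a * M := by positivity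
    have e2 : 0 ≤ a * a * T := by positivity
    nlinarith
  have h7 : T * (1 + 5 / 2 * a) ≤ (1 - 29 / 10 * a) * (T * (1 + 7 * a)) := by
    have e1 : 0 ≤ a * T := by positivity
    have e2 : a * (a * T) ≤ 1 / 35 * (a * T) := by gcongr
    nlinarith
  exact le_of_mul_le_mul_left (h6.trans h7) (by linarith)

end Deterministic

/-! ### From the voters to the majority vote -/

section Majority

/-- A wrong vote for `true` has more than t/2 wrong voters; a wrong vote for `false`, which also
wins ties, has at least t/2. -/
lemma le_two_mul_card_of_maj_ne {X : Type*} {t : ℕ} {f : Fin t → X → Bool} {p : X × Bool}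
    (h : p ∈ errSet (maj f)) :
    (t : ℝ) ≤ 2 * ∑ r, (errSet (maj f) ∩ errSet (f r)).indicator 1 p := by
  have h1 : ∀ r, (errSet (maj f) ∩ errSet (f r)).indicator (1 : X × Bool → ℝ) p =
      if f r p.1 ≠ p.2 then 1 else 0 := by
    intro r
    by_cases hr : f r p.1 ≠ p.2
    · rw [Set.indicator_of_mem (Set.mem_inter h hr), if_pos hr]; rfl
    · rw [Set.indicator_of_notMem (fun hh => hr hh.2), if_neg hr]
  simp only [h1, Finset.sum_boole]
  have h2 : maj f p.1 ≠ p.2 := h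
  have h3 := Finset.card_filter_add_card_filter_not (s := (Finset.univ : Finset (Fin t)))
    (fun r => f r p.1 = true)
  rw [Finset.card_univ, Fintype.card_fin] at h3
  unfold maj at h2
  norm_cast
  cases hp : p.2
  · rw [hp] at h2
    have h4 : t < 2 * (Finset.univ.filter fun r => f r p.1 = true).card := by simpa using h2
    have h5 : (Finset.univ.filter fun r => f r p.1 ≠ false) =
        Finset.univ.filter fun r => f r p.1 = true := by simp
    rw [h5]; exact h4.le
  · rw [hp] at h2
    have h4 : ¬ t < 2 * (Finset.univ.filter fun r => f r p.1 = true).card := by simpa using h2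
    lia

lemma measurable_maj {X : Type*} [MeasurableSpace X] {t : ℕ} {f : Fin t → X → Bool}
    (hf : ∀ r, Measurable (f r)) : Measurable (maj f) := by
  apply measurable_to_bool
  have h1 : Measurable fun x => ∑ r, if f r x = true then (1 : ℕ) else 0 :=
    Finset.measurable_sum _ fun r _ =>
      Measurable.ite (hf r (measurableSet_singleton true)) measurable_const measurable_const
  have h2 : maj f ⁻¹' {true} = {x | t < 2 * ∑ r, if f r x = true then (1 : ℕ) else 0} := by
    ext x
    simp [maj]
  rw [h2]
  exact measurableSet_lt measurable_const (h1.const_mul 2)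

/-- If the majority vote errs, then at least half of the voters err. -/
lemma mul_err_maj_le {X : Type*} [MeasurableSpace X] (μ : Measure (X × Bool))
    [IsProbabilityMeasure μ] {t : ℕ} {f : Fin t → X → Bool} (hf : ∀ r, Measurable (f r)) :
    t * err μ (maj f) ≤ 2 * ∑ r, min (err μ (f r)) (err μ (maj f)) := by
  have hW := measurableSet_errSet (measurable_maj hf)
  have hE := fun r => measurableSet_errSet (hf r)
  -- Intersecting with the error set of the vote is what later truncates each voter's error at that
  -- of the vote.
  have h1 : ∀ p, (errSet (maj f)).indicator (fun _ => (t : ℝ)) p ≤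
      2 * ∑ r, (errSet (maj f) ∩ errSet (f r)).indicator 1 p := by
    intro p
    by_cases hp : p ∈ errSet (maj f)
    · rw [Set.indicator_of_mem hp]
      exact le_two_mul_card_of_maj_ne hp
    · rw [Set.indicator_of_notMem hp]
      exact mul_nonneg zero_le_two (Finset.sum_nonneg fun r _ =>
        Set.indicator_nonneg (fun _ _ => zero_le_one) _)
  have hi : ∀ r, Integrable ((errSet (maj f) ∩ errSet (f r)).indicator (1 : X × Bool → ℝ)) μ :=
    fun r => (integrable_const (1 : ℝ)).indicator (hW.inter (hE r))
  have h2 := integral_mono ((integrable_const (t : ℝ)).indicator hW)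
    ((integrable_finsetSum _ fun r _ => hi r).const_mul 2) h1
  rw [integral_indicator_const _ hW, integral_const_mul, integral_finsetSum _ fun r _ => hi r] at h2
  simp only [integral_indicator_one (hW.inter (hE _)), smul_eq_mul] at h2
  calc t * err μ (maj f) = μ.real (errSet (maj f)) * t := mul_comm _ _
    _ ≤ _ := h2
    _ ≤ _ := by
      gcongr with r _
      exact le_min (measureReal_mono Set.inter_subset_right)
        (measureReal_mono Set.inter_subset_left)

/-- The error of the majority vote in terms of the truncated errors of the voters. -/
lemma err_maj_le {X : Type*} [MeasurableSpace X] (μ : Measure (X × Bool))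
    [IsProbabilityMeasure μ] {t : ℕ} (ht : 0 < t) {f : Fin t → X → Bool}
    (hf : ∀ r, Measurable (f r)) {a Q : ℝ} (ha : 0 < a) (ha1 : a ≤ 1 / 35) (hQ : 0 < Q)
    (h : ∑ r, min (a ^ 2 / Q * err μ (f r)) a ≤ a ^ 2 * t * (1 + 7 * a)) :
    err μ (maj f) ≤ 2 * (1 + 7 * a) * Q := by
  have h1 := mul_err_maj_le μ hf
  set P := err μ (maj f) with hP
  have hP0 : 0 ≤ P := measureReal_nonneg
  have ht0 : (0 : ℝ) < t := by exact_mod_cast ht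
  -- If P ≤ Q/a, the cap a rescaled by Q/a² lies above P and the bound is direct. Otherwise
  -- rescaling by P/a gives tP ≤ 2a(1 + 7a)tP ≤ tP/2, which is absurd.
  rcases le_or_gt (P * a) Q with hPQ | hPQ
  · have h2 : ∀ r, min (err μ (f r)) P ≤ Q / a ^ 2 * min (a ^ 2 / Q * err μ (f r)) a := by
      intro r
      rw [mul_min_of_nonneg _ _ (by positivity)]
      refine min_le_min (le_of_eq (by field_simp)) ?_
      rw [div_mul_eq_mul_div, le_div_iff₀ (by positivity)]
      nlinarith
    have h3 : ∑ r, min (err μ (f r)) P ≤ Q / a ^ 2 * (a ^ 2 * t * (1 + 7 * a)) := by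
      refine (Finset.sum_le_sum fun r _ => h2 r).trans ?_
      rw [← Finset.mul_sum]
      gcongr
    have h4 : Q / a ^ 2 * (a ^ 2 * t * (1 + 7 * a)) = t * (Q * (1 + 7 * a)) := by field_simp
    have h5 : t * P ≤ t * (2 * (1 + 7 * a) * Q) := by linarith
    exact le_of_mul_le_mul_left h5 ht0
  · exfalso
    have hPpos : 0 < P := by
      by_contra hh
      nlinarith
    have h2 : ∀ r, min (err μ (f r)) P ≤ P / a * min (a ^ 2 / Q * err μ (f r)) a := by
      intro r
      have hx : 0 ≤ err μ (f r) := measureReal_nonneg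
      rw [mul_min_of_nonneg _ _ (by positivity)]
      refine min_le_min ?_ (le_of_eq (by field_simp))
      have e1 : P / a * (a ^ 2 / Q * err μ (f r)) = (P * a / Q) * err μ (f r) := by field_simp
      rw [e1]
      have e2 : 1 ≤ P * a / Q := by rw [le_div_iff₀ hQ]; linarith
      nlinarith
    have h3 : ∑ r, min (err μ (f r)) P ≤ P / a * (a ^ 2 * t * (1 + 7 * a)) := by
      refine (Finset.sum_le_sum fun r _ => h2 r).trans ?_
      rw [← Finset.mul_sum]
      gcongr
    have h4 : P / a * (a ^ 2 * t * (1 + 7 * a)) = t * P * (a * (1 + 7 * a)) := by field_simp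
    have h5 : 0 < t * P := by positivity
    have h6 : a * (1 + 7 * a) ≤ 1 / 4 := by nlinarith
    have h7 : t * P * (a * (1 + 7 * a)) ≤ t * P * (1 / 4) := by gcongr
    linarith

end Majority

/-! ### Comparison with OPT -/

section Opt

variable {X : Type*} [MeasurableSpace X] {k : ℕ} {F : Set (X → Bool)}
  (D : Fin k → Measure (X × Bool))

lemma OPT_nonneg : 0 ≤ OPT F D :=
  Real.iInf_nonneg fun _ => Real.iSup_nonneg fun _ => measureReal_nonneg

/-- The infimum need not be attained, so the comparison classifier carries a slack. -/
lemma exists_err_le_OPT_add (hF : F.Nonempty) {η : ℝ} (hη : 0 < η) :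
    ∃ f ∈ F, ∀ i, err (D i) f ≤ OPT F D + η := by
  have := hF.to_subtype
  obtain ⟨f, hf⟩ := exists_lt_of_ciInf_lt (show (⨅ f : F, ⨆ i : Fin k, err (D i) f.1) <
    OPT F D + η by rw [← OPT]; linarith)
  exact ⟨f.1, f.2, fun i => (le_ciSup (Set.finite_range _).bddAbove i).trans hf.le⟩

variable [∀ i, IsProbabilityMeasure (D i)] {nS nT : ℕ} {O : LearningRule X} {α ε : ℝ}

lemma err_output_le (hα : 0 < α) (hε : 0 < ε) (ha : aPar α ≤ 1 / 35) {t : ℕ} (ht : 0 < t)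
    (hO : IsMeasurableRule O) (hERM : IsERM F (ePar ε) O) {f₀ : X → Bool} (hf₀ : f₀ ∈ F)
    {h : Fin t → RoundData X k nS nT}
    (hgood : ∀ j, h j ∉ badRound O α ε D f₀ (OPT F D + ePar ε) (weightAt O α ε h j)) {i : Fin k}
    (hsum : ∑ j, min (scale O α ε (h j).1 * err (D i) (O nS (h j).1)) (aPar α) ≤
      aPar α ^ 2 * t * (1 + 7 * aPar α)) :
    err (D i) (output O h) ≤ (2 + α) * OPT F D + ε := by
  have ha0 := aPar_pos hα
  have he0 := ePar_pos hε
  have hα' : α = 35 * aPar α := by unfold aPar; ring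
  have hε' : ε = 60 * ePar ε := by unfold ePar; ring
  have hopt := OPT_nonneg (F := F) D
  set θ := OPT F D
  set a := aPar α with ha_def
  set e := ePar ε with he_def
  -- A bound for every score denominator: f₀ has sample error at most (1 + a)(θ + e) + e in a good
  -- round, and the minimizer loses at most another e.
  set Q := (1 + 3 * a) * ((1 + a) * (θ + e) + 2 * e) + 3 * e with hQ
  have hQ0 : 0 < Q := by positivity
  have hscale : ∀ j, a ^ 2 / Q ≤ scale O α ε (h j).1 := by
    intro j
    have h1 : empErr (h j).1 f₀ ≤ (1 + a) * (θ + e) + e :=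
      not_lt.1 fun hh => hgood j (Or.inr hh)
    have h2 := (hERM nS (h j).1).2
    have h3 : (⨅ f : F, empErr (h j).1 f.1) ≤ empErr (h j).1 f₀ :=
      ciInf_le ⟨0, by rintro _ ⟨f, rfl⟩; exact empErr_nonneg _ _⟩ (⟨f₀, hf₀⟩ : F)
    have h4 := empErr_nonneg (h j).1 (O nS (h j).1)
    unfold scale
    rw [← ha_def, ← he_def, hQ]
    gcongr
    linarith
  have h5 : ∑ j, min (a ^ 2 / Q * err (D i) (O nS (h j).1)) a ≤ a ^ 2 * t * (1 + 7 * a) := by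
    refine le_trans (Finset.sum_le_sum fun j _ => ?_) hsum
    have : 0 ≤ err (D i) (O nS (h j).1) := measureReal_nonneg
    have h6 := hscale j
    gcongr
  have h6 := err_maj_le (D i) ht (f := fun j => O nS (h j).1)
    (fun j => measurable_of_jointly (hO nS) (h j).1) ha0 ha hQ0 h5
  refine h6.trans ?_
  rw [hα', hε', hQ]
  -- Twice 1 + 35a/2 is 2 + α, by α = 35a. The terms in e add up to less than 60e = ε.
  have b1 : (1 + 7 * a) * (1 + 3 * a) * (1 + a) ≤ 1 + 35 / 2 * a := by
    have : a * a ≤ a * (1 / 35) := by gcongr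
    have : a * (a * a) ≤ a * (1 / 35 * (1 / 35)) := by gcongr
    nlinarith
  have b2 : (1 + 7 * a) ≤ 6 / 5 := by linarith
  have b3 : (1 + 7 * a) * (1 + 3 * a) ≤ 2 := by nlinarith
  have c1 := mul_le_mul_of_nonneg_right b1 hopt
  have c2 := mul_le_mul_of_nonneg_right b1 he0.le
  have c3 := mul_le_mul_of_nonneg_right b2 he0.le
  have c4 := mul_le_mul_of_nonneg_right b3 he0.le
  have c5 : a * e ≤ 1 / 35 * e := by gcongr
  linarith

end Opt

/-! ### Probability of success -/

section Success

variable {X : Type*} [MeasurableSpace X] {k nS nT : ℕ} {O : LearningRule X} {α ε : ℝ}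
  {F : Set (X → Bool)} (D : Fin k → Measure (X × Bool)) [∀ i, IsProbabilityMeasure (D i)]

/-- The probability of success of a run, under explicit conditions on the sample sizes. -/
lemma ofReal_le_runLaw (hk : 0 < k) (hα : 0 < α) (hε : 0 < ε) (ha : aPar α ≤ 1 / 35)
    (he : ePar ε ≤ 1) (hF : ∀ f ∈ F, Measurable f) {d : ℕ}
    (hd : ∀ A : Finset X, Shatters F A → A.card ≤ d) (hne : F.Nonempty)
    (hO : IsMeasurableRule O) (hERM : IsERM F (ePar ε) O) {t : ℕ} (ht : 0 < t)
    {δ δ₁ l : ℝ} (hδ₁ : 0 < δ₁) (hδ₁' : δ₁ ≤ 1) (htδ : 4 * t * δ₁ ≤ δ)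
    (hkt : Real.log k ≤ aPar α ^ 3 * t / 2) (hl : 1 ≤ l * aPar α ^ 2)
    (hexp : Real.exp (-(l * (aPar α ^ 3 * t / 2))) ≤ δ / (4 * k))
    (hnT : 0 < nT) (hln : l * aPar α ≤ 3 * ePar ε * nT) (hnS : 0 < nS)
    (hn : 10 * (d * Real.log (20 / (aPar α * ePar ε)) + Real.log (1 / δ₁)) ≤
      aPar α * ePar ε * nS) :
    ENNReal.ofReal (1 - δ) ≤ runLaw nS nT O α ε D t
      {h | ∀ i, err (D i) (output O h) ≤ (2 + α) * OPT F D + ε} := by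
  obtain ⟨f₀, hf₀, hf₀err⟩ := exists_err_le_OPT_add D hne (ePar_pos hε)
  have hl0 : 0 < l := by
    by_contra h
    nlinarith [sq_nonneg (aPar α)]
  have hk1 : (1 : ℝ) ≤ k := by exact_mod_cast hk
  set u := aPar α ^ 3 * t / 2 with hu
  set μ := runLaw nS nT O α ε D t with hμ
  have hprob : IsProbabilityMeasure μ := isProbabilityMeasure_runLaw D hk hα hε hO t
  set G := {h : Fin t → RoundData X k nS nT |
    ∀ i, err (D i) (output O h) ≤ (2 + α) * OPT F D + ε} with hG
  set E₁ := {h : Fin t → RoundData X k nS nT |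
    ∃ j, h j ∈ badRound O α ε D f₀ (OPT F D + ePar ε) (weightAt O α ε h j)} with hE₁
  set E₂ := {h : Fin t → RoundData X k nS nT | l * u < runSum O α ε (avgExcess O α ε D l) h}
    with hE₂
  set E₃ : Fin k → Set (Fin t → RoundData X k nS nT) := fun i =>
    {h | l * u < runSum O α ε (shortfall O α ε D l i) h} with hE₃
  have hcover : Set.univ ⊆ G ∪ (E₁ ∪ (E₂ ∪ ⋃ i, E₃ i)) := by
    intro h _
    by_cases h1 : h ∈ E₁
    · exact Or.inr (Or.inl h1)
    by_cases h2 : h ∈ E₂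
    · exact Or.inr (Or.inr (Or.inl h2))
    by_cases h3 : ∃ i, h ∈ E₃ i
    · exact Or.inr (Or.inr (Or.inr (Set.mem_iUnion.2 h3)))
    left
    intro i
    have h1' : ∀ j, h j ∉ badRound O α ε D f₀ (OPT F D + ePar ε) (weightAt O α ε h j) :=
      fun j hj => h1 ⟨j, hj⟩
    exact err_output_le D hα hε ha ht hO hERM hf₀ h1'
      (sum_truncated_err_le D hk hα hε ha hl0 h1' (not_lt.1 h2)
        (not_lt.1 fun hh => h3 ⟨i, hh⟩) hkt le_rfl)
  have b1 : μ E₁ ≤ t * (ENNReal.ofReal δ₁ + ENNReal.ofReal δ₁) :=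
    runLaw_exists_round_le D hk hα hε hO (measurableSet_badRound D hO (hF f₀ hf₀) _)
      (fun w hw => roundLaw_badRound_le D hα hε ha he hO hd (fun S => (hERM nS S).1)
        (hF f₀ hf₀) hf₀err hnS hδ₁ hδ₁' hn hk hw) t
  have b2 : μ E₂ ≤ ENNReal.ofReal (δ / (4 * k)) :=
    (runLaw_lt_runSum_le D hk hα hε hO (measurable_avgExcess D hO l)
      (fun w hw => lintegral_exp_avgExcess_le_one D hα hε ha hO hl0 hnT hln hk hw) t _).trans
      (ENNReal.ofReal_le_ofReal hexp)
  have b3 : ∀ i, μ (E₃ i) ≤ ENNReal.ofReal (δ / (4 * k)) := fun i =>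
    (runLaw_lt_runSum_le D hk hα hε hO (measurable_shortfall D hO l i)
      (fun w hw => lintegral_exp_shortfall_le_one D hα hε ha hO hl hnT hln hk hw i) t _).trans
      (ENNReal.ofReal_le_ofReal hexp)
  have hδ : 0 ≤ δ := le_trans (by positivity) htδ
  -- The failure budget: 2tδ₁ ≤ δ/2 for bad rounds, at most δ/4 for the average excess, and k ·
  -- δ/(4k) for the shortfalls.
  have b4 : μ (E₁ ∪ (E₂ ∪ ⋃ i, E₃ i)) ≤ ENNReal.ofReal δ := by
    calc _ ≤ μ E₁ + (μ E₂ + ∑ i, μ (E₃ i)) :=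
          (measure_union_le _ _).trans (add_le_add_right ((measure_union_le _ _).trans
            (add_le_add_right (measure_iUnion_fintype_le _ _) _)) _)
      _ ≤ t * (ENNReal.ofReal δ₁ + ENNReal.ofReal δ₁) + (ENNReal.ofReal (δ / (4 * k)) +
            ∑ _i : Fin k, ENNReal.ofReal (δ / (4 * k))) := by
          gcongr with i
          exact b3 i
      _ = ENNReal.ofReal (t * (δ₁ + δ₁) + (δ / (4 * k) + k * (δ / (4 * k)))) := by
          rw [ENNReal.ofReal_add (by positivity) (by positivity),
            ENNReal.ofReal_add (by positivity) (by positivity),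
            ENNReal.ofReal_mul (by positivity), ENNReal.ofReal_mul (by positivity),
            ENNReal.ofReal_add (by positivity) (by positivity)]
          simp
      _ ≤ _ := by
          apply ENNReal.ofReal_le_ofReal
          have e1 : k * (δ / (4 * k)) = δ / 4 := by field_simp
          have e2 : δ / (4 * k) ≤ δ / 4 := by
            apply div_le_div_of_nonneg_left hδ (by norm_num); linarith
          rw [e1]
          linarith
  have b5 : 1 ≤ μ G + ENNReal.ofReal δ := by
    calc (1 : ENNReal) = μ Set.univ := measure_univ.symm
      _ ≤ μ G + μ (E₁ ∪ (E₂ ∪ ⋃ i, E₃ i)) := (measure_mono hcover).trans (measure_union_le _ _)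
      _ ≤ _ := by gcongr
  rw [ENNReal.ofReal_sub _ hδ, ENNReal.ofReal_one]
  exact tsub_le_iff_right.2 b5

/-- Two classifiers that differ at x shatter {x}. -/
lemma eq_of_vcDim_zero {X : Type*} {F : Set (X → Bool)}
    (hd : ∀ A : Finset X, Shatters F A → A.card ≤ 0) {f g : X → Bool} (hf : f ∈ F) (hg : g ∈ F) :
    f = g := by
  funext x
  by_contra hne
  have : Shatters F {x} := by
    intro b
    by_cases hb : f x = b x
    · exact ⟨f, hf, by simpa using hb⟩
    · refine ⟨g, hg, ?_⟩
      simp only [Finset.mem_singleton, forall_eq]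
      revert hne hb
      cases f x <;> cases g x <;> cases b x <;> simp
  simpa using hd _ this

lemma maj_const {X : Type*} {t : ℕ} (ht : 0 < t) (f : X → Bool) :
    maj (fun _ : Fin t => f) = f := by
  funext x
  cases hx : f x <;> simp [maj, hx]
  lia

/-- The minimizer always returns the only member of F, so the event is the whole space for any
sample sizes, including 0. -/
lemma ofReal_le_runLaw_of_vcDim_zero (hk : 0 < k) (hα : 0 < α) (hε : 0 < ε)
    (hd : ∀ A : Finset X, Shatters F A → A.card ≤ 0) (hne : F.Nonempty)
    (hO : IsMeasurableRule O) (hERM : IsERM F (ePar ε) O) {t : ℕ} (ht : 0 < t) {δ : ℝ}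
    (hδ : 0 < δ) :
    ENNReal.ofReal (1 - δ) ≤ runLaw nS nT O α ε D t
      {h | ∀ i, err (D i) (output O h) ≤ (2 + α) * OPT F D + ε} := by
  have hprob : IsProbabilityMeasure (runLaw nS nT O α ε D t) :=
    isProbabilityMeasure_runLaw D hk hα hε hO t
  obtain ⟨f, hf, hferr⟩ := exists_err_le_OPT_add D hne hε
  have hall : {h : Fin t → RoundData X k nS nT |
      ∀ i, err (D i) (output O h) ≤ (2 + α) * OPT F D + ε} = Set.univ := by
    refine Set.eq_univ_of_forall fun h i => ?_
    have h1 : output O h = f := by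
      unfold output
      simp_rw [fun r => eq_of_vcDim_zero hd (hERM nS (h r).1).1 hf]
      exact maj_const ht f
    rw [h1]
    have := OPT_nonneg (F := F) D
    nlinarith [hferr i]
  rw [hall, measure_univ]
  exact ENNReal.ofReal_le_one.2 (by linarith)

end Success

/-! ### Estimates for the parameters -/

section Parameters

variable {k : ℕ} {α ε δ : ℝ}

lemma log_two_le_log (hk : 2 ≤ k) : 69 / 100 ≤ Real.log k := by
  have : Real.log 2 ≤ Real.log k := Real.log_le_log (by norm_num) (by exact_mod_cast hk)
  linarith [Real.log_two_gt_d9]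

lemma log_le_log_div (hk : 2 ≤ k) (hδ : 0 < δ) (hδ1 : δ < 1) :
    69 / 100 ≤ Real.log (k / δ) := by
  have hk' : (2 : ℝ) ≤ k := by exact_mod_cast hk
  refine (log_two_le_log hk).trans (Real.log_le_log (by positivity) ?_)
  rw [le_div_iff₀ hδ]
  nlinarith

lemma log_div_aPar_cube_ge (hk : 2 ≤ k) (ha0 : 0 < aPar α) (ha : aPar α ≤ 1 / 35) :
    9999 ≤ Real.log k / aPar α ^ 3 := by
  have h1 := log_two_le_log hk
  rw [le_div_iff₀ (by positivity)]
  have : aPar α ^ 3 ≤ (1 / 35) ^ 3 := by gcongr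
  nlinarith

lemma le_rounds : 2 * (Real.log k / aPar α ^ 3) ≤ rounds k α := by
  unfold rounds
  push_cast
  gcongr
  exact Nat.le_ceil _

lemma rounds_le (hk : 2 ≤ k) (ha0 : 0 < aPar α) (ha : aPar α ≤ 1 / 35) :
    (rounds k α : ℝ) ≤ 4 * (Real.log k / aPar α ^ 3) := by
  have h1 := log_div_aPar_cube_ge hk ha0 ha
  have h2 := Nat.ceil_lt_add_one (show 0 ≤ Real.log k / aPar α ^ 3 by linarith)
  unfold rounds
  push_cast
  linarith

/-- From ln k ≤ k and ε' ≤ α' the number of rounds is at most 4k/ε'³; the remaining constant 16 fits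
into a fourth factor 1/ε' ≥ 60. -/
lemma log_one_div_dPar_le (hk : 2 ≤ k) (hδ : 0 < δ) (ha0 : 0 < aPar α)
    (ha : aPar α ≤ 1 / 35) (he0 : 0 < ePar ε) (he : ePar ε ≤ 1 / 60)
    (hea : ePar ε ≤ aPar α) :
    Real.log (1 / dPar k α δ) ≤ Real.log (k / δ) + 4 * Real.log (1 / ePar ε) := by
  have hk' : (2 : ℝ) ≤ k := by exact_mod_cast hk
  have ht := rounds_le hk ha0 ha
  have ht0 : (0 : ℝ) < rounds k α := by
    have := le_rounds (k := k) (α := α)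
    linarith [log_div_aPar_cube_ge hk ha0 ha]
  have h1 : Real.log k ≤ k := (Real.log_le_sub_one_of_pos (by linarith)).trans (by linarith)
  have h2 : 1 / dPar k α δ ≤ k / δ * (1 / ePar ε) ^ 4 := by
    unfold dPar
    calc 1 / (δ / (4 * rounds k α)) = 4 * rounds k α / δ := by field_simp
      _ ≤ 4 * (4 * (k / ePar ε ^ 3)) / δ := by
        gcongr
        refine ht.trans ?_
        gcongr
      _ = k / δ * (16 * (1 / ePar ε) ^ 3) := by field_simp; norm_num
      _ ≤ k / δ * ((1 / ePar ε) * (1 / ePar ε) ^ 3) := by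
        gcongr
        rw [le_div_iff₀ he0]
        linarith
      _ = _ := by ring
  have hd0 : 0 < dPar k α δ := by unfold dPar; positivity
  refine (Real.log_le_log (by positivity) h2).trans ?_
  rw [Real.log_mul (by positivity) (by positivity), Real.log_pow]
  norm_num

/-- Staying away from ε = 1 keeps ln(1/ε) ≥ 1/7, and ln 60 ≤ 59 gives 414 = 7 · 59 + 1. -/
lemma log_one_div_ePar_le (hε : 0 < ε) (hε1 : ε ≤ 6 / 7) :
    Real.log (1 / ePar ε) ≤ 414 * Real.log (1 / ε) := by
  have h1 : 1 / ePar ε = 60 * (1 / ε) := by unfold ePar; field_simp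
  have h2 : 1 / 7 ≤ Real.log (1 / ε) := by
    have := Real.one_sub_inv_le_log_of_pos (show 0 < 1 / ε by positivity)
    rw [one_div, inv_inv] at this
    rw [one_div ε]
    linarith
  have h3 : Real.log 60 ≤ 60 - 1 := Real.log_le_sub_one_of_pos (by norm_num)
  rw [h1, Real.log_mul (by norm_num) (by positivity)]
  linarith

end Parameters

/-! ### Sample sizes and the total count -/

section SampleSizes

variable {d k : ℕ} {ε δ α : ℝ}

/-- The size of the samples from the mixtures. -/
noncomputable def mixtureSampleSize (d k : ℕ) (ε δ α : ℝ) : ℕ :=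
  ⌈30 * (1 / (aPar α * ePar ε) * (d * Real.log (1 / ePar ε) + Real.log (1 / dPar k α δ)))⌉₊

/-- The size of the samples from the single players. -/
noncomputable def playerSampleSize (k : ℕ) (ε δ α : ℝ) : ℕ :=
  ⌈1 / (aPar α * ePar ε) * Real.log (k / δ)⌉₊

lemma dPar_pos (hk : 2 ≤ k) (hδ : 0 < δ) (ha0 : 0 < aPar α) (ha : aPar α ≤ 1 / 35) :
    0 < dPar k α δ := by
  have h1 := log_div_aPar_cube_ge hk ha0 ha
  have h2 := le_rounds (k := k) (α := α)
  unfold dPar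
  have : (0 : ℝ) < rounds k α := by linarith
  positivity

lemma dPar_le (hk : 2 ≤ k) (hδ : 0 < δ) (ha0 : 0 < aPar α) (ha : aPar α ≤ 1 / 35) :
    dPar k α δ ≤ δ / 9999 := by
  have h1 := log_div_aPar_cube_ge hk ha0 ha
  have h2 := le_rounds (k := k) (α := α)
  unfold dPar
  apply div_le_div_of_nonneg_left hδ.le (by norm_num)
  linarith

lemma one_le_log_one_div_dPar (hk : 2 ≤ k) (hδ : 0 < δ) (hδ1 : δ < 1) (ha0 : 0 < aPar α)
    (ha : aPar α ≤ 1 / 35) : 1 ≤ Real.log (1 / dPar k α δ) := by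
  have h1 := dPar_le hk hδ ha0 ha
  have h2 := dPar_pos hk hδ ha0 ha
  rw [Real.le_log_iff_exp_le (by positivity), le_div_iff₀ h2]
  have := Real.exp_one_lt_d9
  nlinarith

lemma one_le_one_div_mul (ha0 : 0 < aPar α) (ha : aPar α ≤ 1 / 35) (he0 : 0 < ePar ε)
    (he : ePar ε ≤ 1 / 60) : 1 ≤ 1 / (aPar α * ePar ε) := by
  rw [le_div_iff₀ (by positivity)]
  nlinarith

lemma mixtureSampleSize_le (hk : 2 ≤ k) (hδ : 0 < δ) (hδ1 : δ < 1) (ha0 : 0 < aPar α)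
    (ha : aPar α ≤ 1 / 35) (he0 : 0 < ePar ε) (he : ePar ε ≤ 1 / 60) :
    (mixtureSampleSize d k ε δ α : ℝ) ≤
      31 * (1 / (aPar α * ePar ε) *
        (d * Real.log (1 / ePar ε) + Real.log (1 / dPar k α δ))) := by
  have h1 := one_le_log_one_div_dPar hk hδ hδ1 ha0 ha
  have h2 := one_le_one_div_mul ha0 ha he0 he
  have h3 : 0 ≤ d * Real.log (1 / ePar ε) := by
    refine mul_nonneg (Nat.cast_nonneg d) (Real.log_nonneg ?_)
    rw [le_div_iff₀ he0]
    linarith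
  have h4 : 1 ≤ 1 / (aPar α * ePar ε) *
      (d * Real.log (1 / ePar ε) + Real.log (1 / dPar k α δ)) :=
    one_le_mul_of_one_le_of_one_le h2 (by linarith)
  unfold mixtureSampleSize
  have := Nat.ceil_lt_add_one (show 0 ≤ 30 * (1 / (aPar α * ePar ε) *
      (d * Real.log (1 / ePar ε) + Real.log (1 / dPar k α δ))) by linarith)
  linarith

lemma playerSampleSize_le (hk : 2 ≤ k) (hδ : 0 < δ) (hδ1 : δ < 1) (ha0 : 0 < aPar α)
    (ha : aPar α ≤ 1 / 35) (he0 : 0 < ePar ε) (he : ePar ε ≤ 1 / 60) :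
    (playerSampleSize k ε δ α : ℝ) ≤ 3 * (1 / (aPar α * ePar ε) * Real.log (k / δ)) := by
  have h1 := log_le_log_div hk hδ hδ1
  have h2 := one_le_one_div_mul ha0 ha he0 he
  have h4 : 1 * (69 / 100) ≤ 1 / (aPar α * ePar ε) * Real.log (k / δ) :=
    mul_le_mul h2 h1 (by norm_num) (by linarith)
  unfold playerSampleSize
  have := Nat.ceil_lt_add_one (show 0 ≤ 1 / (aPar α * ePar ε) * Real.log (k / δ) by linarith)
  linarith

lemma sampleCount_le (hd : 1 ≤ d) (hk : 2 ≤ k) (hε : 0 < ε) (hε1 : ε ≤ 6 / 7) (hδ : 0 < δ)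
    (hδ1 : δ < 1) (ha0 : 0 < aPar α) (ha : aPar α ≤ 1 / 35) (he0 : 0 < ePar ε)
    (he : ePar ε ≤ 1 / 60) (hea : ePar ε ≤ aPar α) :
    (sampleCount k (mixtureSampleSize d k ε δ α) (playerSampleSize k ε δ α) α : ℝ) ≤
      10 ^ 14 * (Real.log k / (α ^ 4 * ε) * (d * Real.log (1 / ε) + k * Real.log (k / δ))) := by
  have hk' : (2 : ℝ) ≤ k := by exact_mod_cast hk
  have hd' : (1 : ℝ) ≤ d := by exact_mod_cast hd
  have h1 := mixtureSampleSize_le (d := d) hk hδ hδ1 ha0 ha he0 he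
  have h2 := playerSampleSize_le hk hδ hδ1 ha0 ha he0 he
  have h3 := rounds_le hk ha0 ha
  have h4 := log_one_div_dPar_le hk hδ ha0 ha he0 he hea
  have h5 := log_one_div_ePar_le hε hε1
  have hL := log_le_log_div hk hδ hδ1
  have hlogk := log_two_le_log hk
  have hl0 : 0 ≤ Real.log (1 / ε) := by
    apply Real.log_nonneg
    rw [le_div_iff₀ hε]
    linarith
  set L := Real.log (k / δ)
  set E := Real.log (1 / ε)
  set E' := Real.log (1 / ePar ε)
  have hE'0 : 0 ≤ E' := by
    apply Real.log_nonneg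
    rw [le_div_iff₀ he0]
    linarith
  have hdE : d * E' ≤ d * (414 * E) := by gcongr
  have hE' : E' ≤ d * E' := le_mul_of_one_le_left hE'0 hd'
  have hkL : L ≤ k * L := le_mul_of_one_le_left (by linarith) (by linarith)
  -- Because d ≥ 1, the summand 4E' of ln(1/δ') is absorbed by 4dE'; then 64170 = 31 · 5 · 414.
  have hsum : 31 * (d * E' + Real.log (1 / dPar k α δ)) + 3 * (k * L) ≤
      64170 * (d * E + k * L) := by
    have : 0 ≤ k * L := by positivity
    linarith
  unfold sampleCount
  push_cast
  calc (rounds k α : ℝ) * (mixtureSampleSize d k ε δ α + k * playerSampleSize k ε δ α)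
      ≤ 4 * (Real.log k / aPar α ^ 3) * (31 * (1 / (aPar α * ePar ε) *
        (d * E' + Real.log (1 / dPar k α δ))) + k * (3 * (1 / (aPar α * ePar ε) * L))) := by
        gcongr
    _ = 4 * (Real.log k / aPar α ^ 3) * (1 / (aPar α * ePar ε)) *
        (31 * (d * E' + Real.log (1 / dPar k α δ)) + 3 * (k * L)) := by ring
    _ ≤ 4 * (Real.log k / aPar α ^ 3) * (1 / (aPar α * ePar ε)) *
        (64170 * (d * E + k * L)) := by gcongr
    _ = 4 * 64170 * 35 ^ 4 * 60 * (Real.log k / (α ^ 4 * ε) * (d * E + k * L)) := by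
        have hα : α ≠ 0 := by
          rintro rfl
          simp [aPar] at ha0
        unfold aPar ePar
        field_simp
    _ ≤ _ := by
        gcongr
        norm_num

/-- The logarithm of 20/(α'ε') is at most 3 ln(1/ε'), which turns the factor 10 into the 30 of the
sample size. -/
lemma mixtureSampleSize_sufficient (hk : 2 ≤ k) (hδ : 0 < δ) (hδ1 : δ < 1) (ha0 : 0 < aPar α)
    (ha : aPar α ≤ 1 / 35) (he0 : 0 < ePar ε) (he : ePar ε ≤ 1 / 60)
    (hea : ePar ε ≤ aPar α / 2) :
    10 * (d * Real.log (20 / (aPar α * ePar ε)) + Real.log (1 / dPar k α δ)) ≤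
      aPar α * ePar ε * mixtureSampleSize d k ε δ α := by
  have h1 := one_le_log_one_div_dPar hk hδ hδ1 ha0 ha
  have h2 : Real.log (20 / (aPar α * ePar ε)) ≤ 3 * Real.log (1 / ePar ε) := by
    have : (3 : ℝ) = (3 : ℕ) := by norm_num
    rw [this, ← Real.log_pow]
    apply Real.log_le_log (by positivity)
    rw [one_div_pow, div_le_div_iff₀ (by positivity) (by positivity)]
    have : 20 * ePar ε ^ 2 ≤ aPar α := by nlinarith
    calc 20 * ePar ε ^ 3 = 20 * ePar ε ^ 2 * ePar ε := by ring
      _ ≤ aPar α * ePar ε := by gcongr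
      _ = _ := by ring
  have h3 : 30 * (1 / (aPar α * ePar ε) *
      (d * Real.log (1 / ePar ε) + Real.log (1 / dPar k α δ))) ≤ mixtureSampleSize d k ε δ α :=
    Nat.le_ceil _
  calc _ ≤ 10 * (d * (3 * Real.log (1 / ePar ε)) + 3 * Real.log (1 / dPar k α δ)) := by
        gcongr
        linarith
    _ = aPar α * ePar ε * (30 * (1 / (aPar α * ePar ε) *
        (d * Real.log (1 / ePar ε) + Real.log (1 / dPar k α δ)))) := by field_simp; ring
    _ ≤ _ := by gcongr

lemma mixtureSampleSize_pos (hk : 2 ≤ k) (hδ : 0 < δ) (hδ1 : δ < 1) (ha0 : 0 < aPar α)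
    (ha : aPar α ≤ 1 / 35) (he0 : 0 < ePar ε) (he : ePar ε ≤ 1 / 60) :
    0 < mixtureSampleSize d k ε δ α := by
  have h1 := one_le_log_one_div_dPar hk hδ hδ1 ha0 ha
  have h3 : 0 ≤ d * Real.log (1 / ePar ε) := by
    refine mul_nonneg (Nat.cast_nonneg d) (Real.log_nonneg ?_)
    rw [le_div_iff₀ he0]
    linarith
  unfold mixtureSampleSize
  rw [Nat.ceil_pos]
  have : 0 < d * Real.log (1 / ePar ε) + Real.log (1 / dPar k α δ) := by linarith
  positivity

/-- The exponent is ln(k/δ) · α't with α't ≥ 3, and 3 ln(k/δ) ≥ ln(4k/δ). The number of rounds thus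
compensates for small player samples. -/
lemma exp_neg_rate_le (hk : 2 ≤ k) (hδ : 0 < δ) (hδ1 : δ < 1) (ha0 : 0 < aPar α)
    (ha : aPar α ≤ 1 / 35) :
    Real.exp (-(2 * Real.log (k / δ) / aPar α ^ 2 * (aPar α ^ 3 * rounds k α / 2))) ≤
      δ / (4 * k) := by
  have hk' : (2 : ℝ) ≤ k := by exact_mod_cast hk
  have hL := log_le_log_div hk hδ hδ1
  have hlogk := log_two_le_log hk
  have h1 : 3 ≤ aPar α * rounds k α := by
    have h2 := le_rounds (k := k) (α := α)
    calc (3 : ℝ) ≤ 2 * (Real.log k / aPar α ^ 2) := by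
          rw [mul_div_assoc', le_div_iff₀ (by positivity)]
          have : aPar α ^ 2 ≤ (1 / 35) ^ 2 := by gcongr
          linarith
      _ = aPar α * (2 * (Real.log k / aPar α ^ 3)) := by field_simp
      _ ≤ _ := by gcongr
  have h2 : 2 * Real.log (k / δ) / aPar α ^ 2 * (aPar α ^ 3 * rounds k α / 2) =
      Real.log (k / δ) * (aPar α * rounds k α) := by field_simp
  rw [h2, ← Real.le_log_iff_exp_le (by positivity)]
  have h3 : Real.log (δ / (4 * k)) = -(Real.log 4 + Real.log (k / δ)) := by
    rw [← Real.log_mul (by norm_num) (by positivity), ← Real.log_inv]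
    congr 1
    field_simp
  have h4 : Real.log 4 ≤ 2 * Real.log (k / δ) := by
    have : Real.log 4 = 2 * Real.log 2 := by
      rw [show (4 : ℝ) = 2 ^ 2 by norm_num, Real.log_pow]; norm_num
    rw [this]
    have : Real.log 2 ≤ Real.log (k / δ) := by
      apply Real.log_le_log (by norm_num)
      rw [le_div_iff₀ hδ]
      nlinarith
    linarith
  rw [h3]
  nlinarith

end SampleSizes

end CollabPAC

/-! ### The theorem -/

theorem theorem3 :
    ∃ C : ℝ, 0 < C ∧
      ∀ (d k : ℕ) (ε δ α : ℝ), 2 ≤ k → 0 < ε → ε < 1 → 0 < δ → δ < 1 → 7 * ε / 6 < α → α < 1 →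
        ∃ nS nT : ℕ,
          (nS : ℝ) ≤ C * (1 / (CollabPAC.aPar α * CollabPAC.ePar ε) *
            (d * Real.log (1 / CollabPAC.ePar ε) + Real.log (1 / CollabPAC.dPar k α δ))) ∧
          (nT : ℝ) ≤ C * (1 / (CollabPAC.aPar α * CollabPAC.ePar ε) *
            Real.log (k / CollabPAC.dPar k α δ)) ∧
          (CollabPAC.sampleCount k nS nT α : ℝ) ≤ C * (Real.log k / (α ^ 4 * ε) *
            (d * Real.log (1 / ε) + k * Real.log (k / δ))) ∧
          ∀ (X : Type*) [MeasurableSpace X] (F : Set (X → Bool)) (O : CollabPAC.LearningRule X)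
            (D : Fin k → Measure (X × Bool)),
            (∀ f ∈ F, Measurable f) → CollabPAC.HasVCDim F d →
            CollabPAC.IsMeasurableRule O → CollabPAC.IsERM F (CollabPAC.ePar ε) O →
            (∀ i, IsProbabilityMeasure (D i)) →
            ENNReal.ofReal (1 - δ) ≤
              CollabPAC.runLaw nS nT O α ε D (CollabPAC.rounds k α)
                {h | ∀ i, CollabPAC.err (D i) (CollabPAC.output O h) ≤
                  (2 + α) * CollabPAC.OPT F D + ε} := by
  open CollabPAC in
  refine ⟨10 ^ 14, by norm_num, ?_⟩
  intro d k ε δ α hk hε hε1 hδ hδ1 hεα hα1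
  have hα : 0 < α := by linarith
  have ha0 : 0 < aPar α := aPar_pos hα
  have he0 : 0 < ePar ε := ePar_pos hε
  have ha : aPar α ≤ 1 / 35 := by unfold aPar; linarith
  have he : ePar ε ≤ 1 / 60 := by unfold ePar; linarith
  -- The inequality ε/60 ≤ α/70 is 7ε/6 ≤ α.
  have hea : ePar ε ≤ aPar α / 2 := by unfold ePar aPar; linarith
  have hk' : (2 : ℝ) ≤ k := by exact_mod_cast hk
  have hL := log_le_log_div hk hδ hδ1
  have hlogk := log_two_le_log hk
  have hlt := log_div_aPar_cube_ge hk ha0 ha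
  have htl := le_rounds (k := k) (α := α)
  have ht0 : (0 : ℝ) < rounds k α := by linarith
  have ht : 0 < rounds k α := by exact_mod_cast ht0
  have hδ' := one_le_log_one_div_dPar hk hδ hδ1 ha0 ha
  have hδ'0 := dPar_pos hk hδ ha0 ha
  have hδ'1 := dPar_le hk hδ ha0 ha
  have hae := one_le_one_div_mul ha0 ha he0 he
  have hE' : 0 ≤ d * Real.log (1 / ePar ε) := by
    refine mul_nonneg (Nat.cast_nonneg d) (Real.log_nonneg ?_)
    rw [le_div_iff₀ he0]
    linarith
  have hE : 0 ≤ d * Real.log (1 / ε) := by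
    refine mul_nonneg (Nat.cast_nonneg d) (Real.log_nonneg ?_)
    rw [le_div_iff₀ hε]
    linarith
  have hLδ' : Real.log (k / δ) ≤ Real.log (k / dPar k α δ) := by
    apply Real.log_le_log (by positivity)
    gcongr
    linarith
  -- For d = 0 the bound on m has no term in ln(1/ε) to absorb ln(1/δ'), so empty samples are used.
  rcases Nat.eq_zero_or_pos d with rfl | hd
  · refine ⟨0, 0, ?_, ?_, ?_, ?_⟩
    · rw [Nat.cast_zero]
      have : 0 ≤ (0 : ℝ) * Real.log (1 / ePar ε) + Real.log (1 / dPar k α δ) := by linarith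
      exact mul_nonneg (by norm_num) (mul_nonneg (by positivity) this)
    · rw [Nat.cast_zero]
      have : 0 ≤ Real.log (k / dPar k α δ) := by linarith
      positivity
    · have h1 : sampleCount k 0 0 α = 0 := by simp [sampleCount]
      rw [h1, Nat.cast_zero]
      have : 0 ≤ (0 : ℝ) * Real.log (1 / ε) + k * Real.log (k / δ) := by
        rw [zero_mul, zero_add]; exact mul_nonneg (by linarith) (by linarith)
      exact mul_nonneg (by norm_num) (mul_nonneg (by positivity) this)
    · intro X _ F O D hF hVC hO hERM hD
      exact ofReal_le_runLaw_of_vcDim_zero D (by lia) hα hε hVC.2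
        ⟨_, (hERM 0 Fin.elim0).1⟩ hO hERM ht hδ
  · refine ⟨mixtureSampleSize d k ε δ α, playerSampleSize k ε δ α, ?_, ?_, ?_, ?_⟩
    · refine (mixtureSampleSize_le hk hδ hδ1 ha0 ha he0 he).trans ?_
      gcongr
      norm_num
    · refine (playerSampleSize_le hk hδ hδ1 ha0 ha he0 he).trans ?_
      gcongr
      norm_num
    · exact sampleCount_le hd hk hε (by linarith) hδ hδ1 ha0 ha he0 he (by linarith)
    · intro X _ F O D hF hVC hO hERM hD
      have hnT : 1 / (aPar α * ePar ε) * Real.log (k / δ) ≤ playerSampleSize k ε δ α :=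
        Nat.le_ceil _
      -- The rate l is large enough that l α'² = 2 ln(k/δ) ≥ 1, and small enough that l α' = 2
      -- ln(k/δ)/α' is below 3ε' nT.
      refine ofReal_le_runLaw D (by lia) hα hε ha (by linarith) hF hVC.2
        ⟨_, (hERM 0 Fin.elim0).1⟩ hO hERM ht (δ₁ := dPar k α δ)
        (l := 2 * Real.log (k / δ) / aPar α ^ 2) hδ'0 (by linarith) ?_ ?_ ?_
        (exp_neg_rate_le hk hδ hδ1 ha0 ha) ?_ ?_
        (mixtureSampleSize_pos hk hδ hδ1 ha0 ha he0 he)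
        (mixtureSampleSize_sufficient hk hδ hδ1 ha0 ha he0 he hea)
      · unfold dPar
        exact le_of_eq (by field_simp)
      · have h1 : aPar α ^ 3 * (2 * (Real.log k / aPar α ^ 3)) ≤ aPar α ^ 3 * rounds k α := by
          gcongr
        have h2 : aPar α ^ 3 * (2 * (Real.log k / aPar α ^ 3)) = 2 * Real.log k := by field_simp
        linarith
      · rw [div_mul_cancel₀ _ (by positivity)]
        linarith
      · unfold playerSampleSize
        rw [Nat.ceil_pos]
        positivity
      · calc 2 * Real.log (k / δ) / aPar α ^ 2 * aPar α = 2 * (Real.log (k / δ) / aPar α) := by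
              field_simp
          _ ≤ 3 * (Real.log (k / δ) / aPar α) := by
              have : 0 ≤ Real.log (k / δ) / aPar α := by positivity
              linarith
          _ = 3 * ePar ε * (1 / (aPar α * ePar ε) * Real.log (k / δ)) := by field_simp
          _ ≤ _ := by gcongr
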